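/- Let $H_{3,d}$ be the real vector space of ternary forms of degree $d$, let $P_{3,6}\subset H_{3,6}$ be the cone of nonnegative ternary sextics and $\Sigma_{3,6}\subset P_{3,6}$ the cone of sums of squares of ternary cubics, and let $\Sigma_{3,6}^*$ be the cone of linear functionals on $H_{3,6}$ that are nonnegative on $\Sigma_{3,6}$. Let $p \in \partial P_{3,6}\setminus\Sigma_{3,6}$, let $0\le k\le 8$, and let $v_1,\dots,v_8\in\mathbb{Q}^3\setminus\{0\}$ represent eight pairwise distinct projective points such that the real projective zero set of $p$ is $\{[v_1],\dots,[v_k]\}$. (Since $p$ lies on the boundary of $P_{3,6}$, necessarily $k\geq 1$.) Assume the genericity condition: no four of $v_1,\dots,v_8$ lie on a line and no seven lie on a quadric. 1. The cubics vanishing at $v_1,\dots,v_8$ have exactly one further intersection point $[v_9]$ in $\mathbb{P}^2(\mathbb{C})$, counted with multiplicity (the ninth point given by Bezout's theorem). That is, there is exactly one point $[v_9]\in\mathbb{P}^2(\mathbb{C})$ at which all these cubics vanish and which either is different from $[v_1],\dots,[v_8]$, or is one of them at which any two of these cubics have linearly dependent gradients. This point is rational, i.e. one can choose $v_9\in\mathbb{Q}^3$.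 2. Let $v_9\in\mathbb{Q}^3$ be any rational representative of this point, and let $u=(u_1,\dots,u_9)\in\mathbb{R}^9\setminus\{0\}$ be a Cayley–Bacharach relation, i.e. $\sum_{j=1}^9 u_j f(v_j)=0$ for all $f\in H_{3,3}$. If $$(u_{k+1}^2+\cdots+u_8^2)\,\bigl(p(v_{k+1})+\cdots+p(v_8)\bigr) < u_9^2\,p(v_9),$$ then there are rational numbers $a_1,\dots,a_9$ such that the functional $l_a: H_{3,6}\to\mathbb{R}$, $l_a(f)=\sum_{j=1}^9 a_j f(v_j)$, spans an extreme ray of $\Sigma_{3,6}^*$ and satisfies $l_a(p)<0$. In particular, $l_a$ is a rational certificate that $p$ is not a sum of squares. -/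

import Mathlib

noncomputable section

namespace TernarySextic

/-- The real vector space of ternary forms (homogeneous polynomials in three variables) of
degree `d`. -/
abbrev TernaryForm (d : ℕ) : Type := ↥(MvPolynomial.homogeneousSubmodule (Fin 3) ℝ d)

/-- The usual topology of the finite-dimensional space of ternary forms: convergence of all
coefficients. -/
instance (d : ℕ) : TopologicalSpace (TernaryForm d) :=
  TopologicalSpace.induced
    (fun (f : TernaryForm d) (m : Fin 3 →₀ ℕ) => MvPolynomial.coeff m (f : MvPolynomial (Fin 3) ℝ))
    inferInstance

/-- Evaluation of forms at a real vector, as a linear functional. -/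
def evalAt {d : ℕ} (x : Fin 3 → ℝ) : TernaryForm d →ₗ[ℝ] ℝ :=
  (MvPolynomial.aeval x).toLinearMap ∘ₗ (MvPolynomial.homogeneousSubmodule (Fin 3) ℝ d).subtype

/-- The cone of nonnegative ternary sextics. -/
def nonnegSextics : Set (TernaryForm 6) :=
  {f | ∀ x : Fin 3 → ℝ, 0 ≤ evalAt x f}

/-- The cone of ternary sextics that are (finite) sums of squares of ternary cubics. -/
def sosSextics : Set (TernaryForm 6) :=
  {f | ∃ (r : ℕ) (g : Fin r → TernaryForm 3),
    (f : MvPolynomial (Fin 3) ℝ) = ∑ i, (g i : MvPolynomial (Fin 3) ℝ) ^ 2}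

/-- The dual cone of the cone of sums of squares. -/
def dualSosCone : Set (TernaryForm 6 →ₗ[ℝ] ℝ) :=
  {l | ∀ f ∈ sosSextics, 0 ≤ l f}

/-- `x` spans an extreme ray of the convex cone `C`. -/
def SpansExtremeRay {E : Type*} [AddCommGroup E] [Module ℝ E] (C : Set E) (x : E) : Prop :=
  x ∈ C ∧ x ≠ 0 ∧
    ∀ y ∈ C, ∀ z ∈ C, y + z = x → (∃ b : ℝ, 0 ≤ b ∧ y = b • x) ∧ (∃ c : ℝ, 0 ≤ c ∧ z = c • x)

/-- The functional `f ↦ ∑ j, a j * f (v j)` on ternary sextics. -/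
def pointFunctional {m : ℕ} (a : Fin m → ℝ) (v : Fin m → Fin 3 → ℝ) :
    TernaryForm 6 →ₗ[ℝ] ℝ :=
  ∑ j, a j • evalAt (v j)

/-- Two (nonzero) vectors represent the same point of the projective plane over `K`. -/
def SamePoint {K : Type*} [Field K] (x y : Fin 3 → K) : Prop :=
  ∃ c : K, c ≠ 0 ∧ y = c • x

/-- No four of the points `v i` lie on a line and no seven on a quadric. -/
def GenericityCondition {m : ℕ} (v : Fin m → Fin 3 → ℝ) : Prop :=
  (∀ L : TernaryForm 1, L ≠ 0 →
    ∀ s : Finset (Fin m), (∀ i ∈ s, evalAt (v i) L = 0) → s.card < 4) ∧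
  (∀ Q : TernaryForm 2, Q ≠ 0 →
    ∀ s : Finset (Fin m), (∀ i ∈ s, evalAt (v i) Q = 0) → s.card < 7)

/-- The ternary cubics vanishing at all the points `v i`. -/
def cubicsThrough {m : ℕ} (v : Fin m → Fin 3 → ℝ) : Set (TernaryForm 3) :=
  {q | ∀ i, evalAt (v i) q = 0}

/-- The gradient of a real ternary form at a complex vector. -/
def gradientAt {d : ℕ} (q : TernaryForm d) (w : Fin 3 → ℂ) : Fin 3 → ℂ :=
  fun i => MvPolynomial.aeval w (MvPolynomial.pderiv i (q : MvPolynomial (Fin 3) ℝ))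

/-- `w` represents the ninth intersection point, in the complex projective plane and counted with
multiplicity, of two cubics spanning the space of cubics through the eight points `v i`:
all these cubics vanish at `w`, and `w` is either different from all the `v i`, or it is one of
them and the cubics do not meet transversely there (their gradients are linearly dependent, that
is, the intersection multiplicity is at least two). -/
structure IsNinthPoint (v : Fin 8 → Fin 3 → ℝ) (w : Fin 3 → ℂ) : Prop where
  ne_zero : w ≠ 0
  vanishing : ∀ q ∈ cubicsThrough v,
    MvPolynomial.aeval w (q : MvPolynomial (Fin 3) ℝ) = 0
  multiple : ∀ i, SamePoint (fun j => (v i j : ℂ)) w →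
    ∀ q ∈ cubicsThrough v, ∀ r ∈ cubicsThrough v,
      crossProduct (gradientAt q w) (gradientAt r w) = 0

/-- `u` is a (nontrivial) Cayley-Bacharach relation for the nine points `v j`. -/
def IsCayleyBacharachRelation (v : Fin 9 → Fin 3 → ℝ) (u : Fin 9 → ℝ) : Prop :=
  u ≠ 0 ∧ ∀ f : TernaryForm 3, ∑ j, u j * evalAt (v j) f = 0

/-- A rational vector, regarded as a real one. -/
def toReal (x : Fin 3 → ℚ) : Fin 3 → ℝ := fun j => (x j : ℝ)

/-- A rational vector, regarded as a complex one. -/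
def toComplex (x : Fin 3 → ℚ) : Fin 3 → ℂ := fun j => (x j : ℂ)

/-- The nine-point configuration consisting of eight points and a last one. -/
def ninePoints (v : Fin 8 → Fin 3 → ℝ) (w : Fin 3 → ℝ) : Fin 9 → Fin 3 → ℝ :=
  Fin.snoc (α := fun _ => Fin 3 → ℝ) v w

end TernarySextic

end

open TernarySextic

noncomputable section

namespace TernarySextic

open MvPolynomial Module Matrix

/-! ### Linear algebra -/

/-! The first claim is liaison reduced to dimension counts. Genericity makes the eight points impose
independent conditions on cubics (`IsGeneric.exists_cubic_avoiding`), so the cubics through them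
form a pencil spanned by `q` and `r`. A common factor would force too many points onto a line or
conic; hence `q` and `r` are coprime and all their syzygies are Koszul (`IsPencil.exists_syzygy`).
Counting dimensions produces a quartic `F` through the eight points outside the ideal `(q, r)` and
independent linear forms `l`, `m` with `l F` and `m F` in `(q, r)` (`IsPencil.exists_isResidual`).
Comparing `m (l F)` with `l (m F)` writes `q` and `r` as combinations of `l` and `m`, so the point
`l = m = 0` is a base point; conversely any ninth point lies on both lines
(`IsResidual.dot_eq_zero`). Everything is linear algebra over the field of the eight points, so the
ninth point is rational.

For the second claim, cubics satisfy `f(v₉) = ∑ ρᵢ f(vᵢ)`, and Cayley–Bacharach relations are `uᵢ =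
-u₉ ρᵢ`. Given weights `aᵢ > 0`, put `S = ∑ ρᵢ² / aᵢ` and `a₉ = -1 / S`. Cauchy–Schwarz makes the
functional nonnegative on squares, and it vanishes on the squares of `q`, `r` and one further cubic,
the equality case. Sextics vanishing at the nine points lie in `(q, r)`, so a summand of the
functional is again a combination of the nine evaluations; the further cubic then fixes its
coefficients up to scale, because no `ρᵢ` is zero (`IsBasePoint.eval_cubic_ne_zero`,
`IsBasePoint.spansExtremeRay`).

The value at `p` is `∑ aᵢ p(vᵢ) - p(v₉) / S`. Weight `1` off the zeros of `p` and a large rational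
weight `T` on them leave the sum unchanged and bring `S` down to `∑ ρᵢ²` over the nonzeros as `T →
∞`; in this limit negativity is the assumed inequality (`exists_rational_certificate`). -/

theorem finrank_ker_pi_add_card {K V ι : Type*} [Field K] [AddCommGroup V] [Module K V]
    [FiniteDimensional K V] [Fintype ι] [DecidableEq ι] (φ : ι → V →ₗ[K] K)
    (hs : ∀ i, ∃ s, φ i s ≠ 0 ∧ ∀ j, j ≠ i → φ j s = 0) :
    finrank K (LinearMap.ker (LinearMap.pi φ)) + Fintype.card ι = finrank K V := by
  choose s hs0 hs1 using hs
  have hsurj : Function.Surjective (LinearMap.pi φ) := by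
    intro x
    refine ⟨∑ i, (x i * (φ i (s i))⁻¹) • s i, ?_⟩
    ext j
    simp only [LinearMap.pi_apply, map_sum, map_smul, smul_eq_mul]
    rw [Finset.sum_eq_single j]
    · rw [mul_assoc, inv_mul_cancel₀ (hs0 j), mul_one]
    · intro b _ hb
      rw [hs1 b j hb.symm, mul_zero]
    · simp
  have h1 := LinearMap.finrank_range_add_finrank_ker (LinearMap.pi φ)
  rw [LinearMap.range_eq_top.2 hsurj, finrank_top, finrank_fintype_fun_eq_card] at h1
  omega

/-- The range of `T` lies in the common kernel of the `φ i`, and `hd` says its dimension is at least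
as large. In the applications to pencils this count plays the role of Max Noether's theorem: forms
through the points are combinations of known ones. -/
theorem exists_preimage_of_forall_eq_zero {K V E ι : Type*} [Field K] [AddCommGroup V] [Module K V]
    [FiniteDimensional K V] [AddCommGroup E] [Module K E] [FiniteDimensional K E] [Fintype ι]
    [DecidableEq ι] (φ : ι → V →ₗ[K] K) (hs : ∀ i, ∃ s, φ i s ≠ 0 ∧ ∀ j, j ≠ i → φ j s = 0)
    (T : E →ₗ[K] V) (hT : ∀ i e, φ i (T e) = 0)
    (hd : finrank K V + finrank K (LinearMap.ker T) ≤ finrank K E + Fintype.card ι)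
    {f : V} (hf : ∀ i, φ i f = 0) : ∃ e, T e = f := by
  have h1 := finrank_ker_pi_add_card φ hs
  have h2 := LinearMap.finrank_range_add_finrank_ker T
  have hle : LinearMap.range T ≤ LinearMap.ker (LinearMap.pi φ) := by
    rintro _ ⟨e, rfl⟩
    ext i
    exact hT i e
  have := Submodule.eq_of_le_of_finrank_le hle (by omega)
  have hmem : f ∈ LinearMap.ker (LinearMap.pi φ) := by
    ext i
    exact hf i
  rwa [← this] at hmem

/-- `T` lands in a subspace of codimension `card ι`, which forces a large kernel. This is how
relations between forms are produced. -/
theorem finrank_add_card_le_finrank_ker_add {K V E ι : Type*} [Field K] [AddCommGroup V]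
    [Module K V] [FiniteDimensional K V] [AddCommGroup E] [Module K E] [FiniteDimensional K E]
    [Fintype ι] [DecidableEq ι] (φ : ι → V →ₗ[K] K)
    (hs : ∀ i, ∃ s, φ i s ≠ 0 ∧ ∀ j, j ≠ i → φ j s = 0)
    (T : E →ₗ[K] V) (hT : ∀ i e, φ i (T e) = 0) :
    finrank K E + Fintype.card ι ≤ finrank K (LinearMap.ker T) + finrank K V := by
  have h1 := finrank_ker_pi_add_card φ hs
  have h2 := LinearMap.finrank_range_add_finrank_ker T
  have hle : LinearMap.range T ≤ LinearMap.ker (LinearMap.pi φ) := by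
    rintro _ ⟨e, rfl⟩
    ext i
    exact hT i e
  have := Submodule.finrank_mono hle
  omega

theorem exists_linearIndependent_pair_mem {K V : Type*} [Field K] [AddCommGroup V] [Module K V]
    {W : Submodule K V} (hW : 1 < finrank K W) :
    ∃ x ∈ W, ∃ y ∈ W, LinearIndependent K ![x, y] := by
  have : Nontrivial W := nontrivial_of_finrank_pos (R := K) (zero_lt_one.trans hW)
  obtain ⟨x, hx⟩ := exists_ne (0 : W)
  obtain ⟨y, hy⟩ := exists_linearIndependent_pair_of_one_lt_finrank hW hx
  refine ⟨x, x.2, y, y.2, ?_⟩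
  rw [LinearIndependent.pair_iff] at hy ⊢
  intro s t hst
  exact hy s t (Subtype.ext (by simpa using hst))

/-! ### Vectors in the plane -/

section Vectors

variable {K : Type*} [Field K]

@[simp] theorem cross_dot_self_left (a b : Fin 3 → K) : a ⨯₃ b ⬝ᵥ a = 0 := by
  rw [dotProduct_comm, dot_self_cross]

@[simp] theorem cross_dot_self_right (a b : Fin 3 → K) : a ⨯₃ b ⬝ᵥ b = 0 := by
  rw [dotProduct_comm, dot_cross_self]

theorem cross_dot_rotate (a b c : Fin 3 → K) : a ⨯₃ b ⬝ᵥ c = b ⨯₃ c ⬝ᵥ a := by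
  simp [cross_apply, dotProduct, Fin.sum_univ_three]
  ring

theorem cross_dot_swap_left (a b c : Fin 3 → K) : a ⨯₃ b ⬝ᵥ c = -(b ⨯₃ a ⬝ᵥ c) := by
  rw [← cross_anticomm, neg_dotProduct]

theorem cross_dot_swap_right (a b c : Fin 3 → K) : a ⨯₃ b ⬝ᵥ c = -(a ⨯₃ c ⬝ᵥ b) := by
  simp [cross_apply, dotProduct, Fin.sum_univ_three]
  ring

theorem exists_smul_of_cross_eq_zero {a b : Fin 3 → K} (ha : a ≠ 0) (h : a ⨯₃ b = 0) :
    ∃ c : K, b = c • a := by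
  have hl : ¬ LinearIndependent K ![a, b] := fun hl =>
    crossProduct_ne_zero_iff_linearIndependent.2 hl h
  rw [LinearIndependent.pair_iff' ha] at hl
  push Not at hl
  obtain ⟨c, hc⟩ := hl
  exact ⟨c, hc.symm⟩

/-- The cross product serves both as the line through two points and as the intersection of two
lines. -/
theorem exists_smul_cross {a b w : Fin 3 → K} (h : a ⨯₃ b ≠ 0) (ha : a ⬝ᵥ w = 0)
    (hb : b ⬝ᵥ w = 0) : ∃ c : K, w = c • (a ⨯₃ b) := by
  apply exists_smul_of_cross_eq_zero h
  have := cross_cross_eq_smul_sub_smul a b w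
  rw [this, ha, hb]
  simp

theorem samePoint_iff_cross {a b : Fin 3 → K} (ha : a ≠ 0) (hb : b ≠ 0) :
    SamePoint a b ↔ a ⨯₃ b = 0 := by
  constructor
  · rintro ⟨c, -, rfl⟩
    simp
  · intro h
    obtain ⟨c, rfl⟩ := exists_smul_of_cross_eq_zero ha h
    exact ⟨c, fun hc => hb (by simp [hc]), rfl⟩

/-- A line through `a` that avoids a different point `b`. -/
theorem exists_dot_eq_zero_ne_zero {a b : Fin 3 → K} (h : a ⨯₃ b ≠ 0) :
    ∃ l : Fin 3 → K, l ⬝ᵥ a = 0 ∧ l ⬝ᵥ b ≠ 0 := by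
  by_contra! hcon
  have key : ∀ x : Fin 3 → K, x ⬝ᵥ (a ⨯₃ b) = 0 := by
    intro x
    rw [triple_product_permutation, triple_product_permutation, dotProduct_comm]
    -- The line used is `x ⨯₃ a`, which passes through `a`.
    exact hcon _ (by rw [dotProduct_comm]; exact dot_cross_self _ _)
  apply h
  ext i
  have := key (Pi.single i 1)
  simpa using this

theorem exists_dot_ne_zero {b : Fin 3 → K} (h : b ≠ 0) : ∃ l : Fin 3 → K, l ⬝ᵥ b ≠ 0 := by
  obtain ⟨i, hi⟩ := Function.ne_iff.1 h
  exact ⟨Pi.single i 1, by simpa using hi⟩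

/-- Two different lines through a point. -/
theorem exists_pair_dot_eq_zero {a : Fin 3 → K} (h : a ≠ 0) :
    ∃ l m : Fin 3 → K, l ⬝ᵥ a = 0 ∧ m ⬝ᵥ a = 0 ∧ l ⨯₃ m ≠ 0 := by
  obtain ⟨i, hi⟩ := Function.ne_iff.1 h
  simp only [Pi.zero_apply] at hi
  -- In each case the `i`-th coordinate of `l ⨯₃ m` is `a i ^ 2`.
  fin_cases i
  · refine ⟨![a 1, -a 0, 0], ![a 2, 0, -a 0], ?_, ?_, fun hc => ?_⟩
    · simp [dotProduct, Fin.sum_univ_three]; ring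
    · simp [dotProduct, Fin.sum_univ_three]; ring
    · have := congrFun hc 0
      simp_all [cross_apply]
  · refine ⟨![a 1, -a 0, 0], ![0, a 2, -a 1], ?_, ?_, fun hc => ?_⟩
    · simp [dotProduct, Fin.sum_univ_three]; ring
    · simp [dotProduct, Fin.sum_univ_three]; ring
    · have := congrFun hc 1
      simp_all [cross_apply]
  · refine ⟨![a 2, 0, -a 0], ![0, a 2, -a 1], ?_, ?_, fun hc => ?_⟩
    · simp [dotProduct, Fin.sum_univ_three]; ring
    · simp [dotProduct, Fin.sum_univ_three]; ring
    · have := congrFun hc 2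
      simp_all [cross_apply]

end Vectors

/-! ### Forms -/

section Forms

variable {K : Type*} [Field K]

/-- Ternary forms over a field. -/
abbrev Form (K : Type*) [Field K] (d : ℕ) : Type _ := ↥(homogeneousSubmodule (Fin 3) K d)

theorem Form.isHomogeneous {d : ℕ} (f : Form K d) : (f : MvPolynomial (Fin 3) K).IsHomogeneous d :=
  f.2

theorem setOf_degree_eq (d : ℕ) : {m : Fin 3 →₀ ℕ | m.degree = d} =
    ((Finset.univ : Finset (Fin 3)).finsuppAntidiag d : Set (Fin 3 →₀ ℕ)) := by
  ext m
  simp [Finsupp.degree_eq_sum]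

/-- Forms are given by their coefficients. -/
def formEquiv (d : ℕ) : Form K d ≃ₗ[K]
    (((Finset.univ : Finset (Fin 3)).finsuppAntidiag d : Set (Fin 3 →₀ ℕ)) →₀ K) :=
  (LinearEquiv.ofEq _ _ (by
    rw [homogeneousSubmodule_eq_finsupp_supported, setOf_degree_eq])).trans
    (AddMonoidAlgebra.supportedEquivFinsupp _)

instance (d : ℕ) : FiniteDimensional K (Form K d) :=
  LinearEquiv.finiteDimensional (formEquiv d).symm

theorem finrank_form (d : ℕ) : finrank K (Form K d) = (d + 2).choose 2 := by
  have h : Fintype.card ((Finset.univ : Finset (Fin 3)).finsuppAntidiag d : Set (Fin 3 →₀ ℕ)) =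
      ((Finset.univ : Finset (Fin 3)).finsuppAntidiag d).card := Fintype.card_coe _
  rw [LinearEquiv.finrank_eq (formEquiv d), finrank_finsupp_self, h,
    Finset.card_finsuppAntidiag_nat_eq_choose, Finset.card_univ, Fintype.card_fin,
    show 3 + d - 1 = d + 2 by omega]
  exact Nat.choose_symm_add

/-- The linear form with given coefficients. -/
def lin (a : Fin 3 → K) : MvPolynomial (Fin 3) K := ∑ i, C (a i) * X i

theorem lin_isHomogeneous (a : Fin 3 → K) : (lin a).IsHomogeneous 1 :=
  IsHomogeneous.sum _ _ _ fun i _ => isHomogeneous_C_mul_X _ i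

theorem aeval_lin {L : Type*} [Field L] [Algebra K L] (a : Fin 3 → K) (w : Fin 3 → L) :
    aeval w (lin a) = (fun i => algebraMap K L (a i)) ⬝ᵥ w := by
  simp [lin, dotProduct]

@[simp] theorem eval_lin (a x : Fin 3 → K) : eval x (lin a) = a ⬝ᵥ x := by
  simp [lin, dotProduct]

theorem lin_add (a b : Fin 3 → K) : lin (a + b) = lin a + lin b := by
  simp [lin, add_mul, Finset.sum_add_distrib]

theorem lin_smul (c : K) (a : Fin 3 → K) : lin (c • a) = c • lin a := by
  simp [lin, smul_eq_C_mul, Finset.mul_sum, mul_assoc]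

theorem pderiv_lin (a : Fin 3 → K) (i : Fin 3) : pderiv i (lin a) = C (a i) := by
  simp only [lin, map_sum, Derivation.leibniz, pderiv_C, pderiv_X, smul_eq_mul]
  simp [Pi.single_apply]

theorem lin_ne_zero {a : Fin 3 → K} (ha : a ≠ 0) : lin a ≠ 0 := by
  intro h
  apply ha
  ext i
  have := pderiv_lin a i
  rw [h, map_zero] at this
  exact (C_injective _ _ (by simpa using this)).symm

theorem exists_eq_lin {f : MvPolynomial (Fin 3) K} (hf : f.IsHomogeneous 1) :
    ∃ a, f = lin a := by
  have h : f ∈ homogeneousSubmodule (Fin 3) K 1 := hf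
  clear hf
  rw [homogeneousSubmodule_one_eq_span_X] at h
  induction h using Submodule.span_induction with
  | mem x hx =>
    obtain ⟨i, rfl⟩ := hx
    refine ⟨Pi.single i 1, ?_⟩
    rw [lin, Finset.sum_eq_single i] <;> simp +contextual
  | zero => exact ⟨0, by simp [lin]⟩
  | add x y _ _ hx hy =>
    obtain ⟨a, rfl⟩ := hx
    obtain ⟨b, rfl⟩ := hy
    exact ⟨a + b, (lin_add _ _).symm⟩
  | smul c x _ hx =>
    obtain ⟨a, rfl⟩ := hx
    exact ⟨c • a, (lin_smul _ _).symm⟩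

/-- Evaluation of forms. -/
def evalForm {d : ℕ} (x : Fin 3 → K) : Form K d →ₗ[K] K :=
  (aeval x).toLinearMap ∘ₗ (homogeneousSubmodule (Fin 3) K d).subtype

@[simp] theorem evalForm_apply {d : ℕ} (x : Fin 3 → K) (f : Form K d) :
    evalForm x f = eval x (f : MvPolynomial (Fin 3) K) := by
  simp [evalForm, aeval_eq_eval]

/-- Multiplication by a fixed form. -/
def mulForm {d e n : ℕ} (h : d + e = n) (q : Form K e) : Form K d →ₗ[K] Form K n :=
  LinearMap.codRestrict _
    (LinearMap.mulRight K (q : MvPolynomial (Fin 3) K) ∘ₗ (homogeneousSubmodule (Fin 3) K d).subtype)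
    fun f => h ▸ f.2.mul q.2

@[simp] theorem coe_mulForm {d e n : ℕ} (h : d + e = n) (q : Form K e) (f : Form K d) :
    (mulForm h q f : MvPolynomial (Fin 3) K) = f * q := rfl

/-- Linear forms. -/
def linForm : (Fin 3 → K) →ₗ[K] Form K 1 where
  toFun a := ⟨lin a, lin_isHomogeneous a⟩
  map_add' a b := Subtype.ext (lin_add a b)
  map_smul' c a := Subtype.ext (lin_smul c a)

@[simp] theorem coe_linForm (a : Fin 3 → K) : (linForm a : MvPolynomial (Fin 3) K) = lin a := rfl

/-- Terms of degree `m + n` can only come from the top degrees of both factors. This allows factors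
of a homogeneous polynomial to be replaced by homogeneous ones. -/
theorem homogeneousComponent_mul_of_totalDegree_le {σ R : Type*} [CommSemiring R]
    {f g : MvPolynomial σ R}
    {m n : ℕ} (hf : f.totalDegree ≤ m) (hg : g.totalDegree ≤ n) :
    homogeneousComponent (m + n) (f * g) = homogeneousComponent m f * homogeneousComponent n g := by
  classical
  ext d
  rw [coeff_homogeneousComponent]
  split_ifs with hd
  · rw [coeff_mul, coeff_mul]
    refine Finset.sum_congr rfl fun x hx => ?_
    rw [Finset.HasAntidiagonal.mem_antidiagonal] at hx
    rw [coeff_homogeneousComponent, coeff_homogeneousComponent]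
    rw [← hx, map_add] at hd
    by_cases h1 : m < x.1.degree
    · rw [coeff_eq_zero_of_totalDegree_lt (f := f)]
      · simp
      · exact lt_of_le_of_lt hf h1
    by_cases h2 : n < x.2.degree
    · rw [coeff_eq_zero_of_totalDegree_lt (f := g)]
      · simp
      · exact lt_of_le_of_lt hg h2
    rw [if_pos (by omega), if_pos (by omega)]
  · exact (((homogeneousComponent_isHomogeneous m f).mul
      (homogeneousComponent_isHomogeneous n g)).coeff_eq_zero hd).symm

theorem isUnit_of_totalDegree_eq_zero {f : MvPolynomial (Fin 3) K} (hf : f ≠ 0)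
    (h : f.totalDegree = 0) : IsUnit f := by
  rw [totalDegree_eq_zero_iff_eq_C] at h
  rw [h] at hf ⊢
  exact (isUnit_iff_ne_zero.2 fun h0 => hf (by rw [h0, C_0])).map C

theorem lin_irreducible {a : Fin 3 → K} (ha : a ≠ 0) : Irreducible (lin a) := by
  apply irreducible_of_totalDegree_eq_one
  · exact (lin_isHomogeneous a).totalDegree (lin_ne_zero ha)
  · intro x hx
    rw [isUnit_iff_ne_zero]
    rintro rfl
    apply lin_ne_zero ha
    ext m
    simpa using hx m

theorem lin_not_dvd_lin {a b : Fin 3 → K} (h : a ⨯₃ b ≠ 0) : ¬ lin a ∣ lin b := by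
  rintro ⟨t, ht⟩
  obtain ⟨x, hx, hx'⟩ : ∃ x, a ⬝ᵥ x = 0 ∧ b ⬝ᵥ x ≠ 0 := by
    obtain ⟨x, h1, h2⟩ := exists_dot_eq_zero_ne_zero h
    exact ⟨x, by rwa [dotProduct_comm], by rwa [dotProduct_comm]⟩
  apply hx'
  have := congrArg (eval x) ht
  simpa [hx] using this

end Forms

/-! ### Points in general position -/

section Configuration

variable {K : Type*} [Field K]

/-- Pairwise distinct projective points, no four on a line and no seven on a quadric. -/
structure IsGeneric {ι : Type*} (v : ι → Fin 3 → K) : Prop where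
  cross_ne : ∀ i j, i ≠ j → v i ⨯₃ v j ≠ 0
  line : ∀ a : Fin 3 → K, a ≠ 0 → ∀ s : Finset ι, (∀ i ∈ s, a ⬝ᵥ v i = 0) → s.card < 4
  quadric : ∀ Q : Form K 2, Q ≠ 0 → ∀ s : Finset ι,
    (∀ i ∈ s, eval (v i) (Q : MvPolynomial (Fin 3) K) = 0) → s.card < 7

namespace IsGeneric

variable {ι : Type*} [DecidableEq ι] {v : ι → Fin 3 → K}

theorem not_collinear (hv : IsGeneric v) {i j k l : ι} (hij : i ≠ j) (hik : i ≠ k) (hil : i ≠ l)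
    (hjk : j ≠ k) (hjl : j ≠ l) (hkl : k ≠ l) (hk : v i ⨯₃ v j ⬝ᵥ v k = 0) :
    v i ⨯₃ v j ⬝ᵥ v l ≠ 0 := by
  intro hl
  have := hv.line _ (hv.cross_ne i j hij) {i, j, k, l} (by
    intro m hm
    simp only [Finset.mem_insert, Finset.mem_singleton] at hm
    rcases hm with rfl | rfl | rfl | rfl
    · exact cross_dot_self_left _ _
    · exact cross_dot_self_right _ _
    · exact hk
    · exact hl)
  rw [Finset.card_insert_of_notMem (by simp [*]), Finset.card_insert_of_notMem (by simp [*]),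
    Finset.card_insert_of_notMem (by simp [*]), Finset.card_singleton] at this
  omega

theorem not_collinear_of_line (hv : IsGeneric v) {x i j k : ι} (hxi : x ≠ i) (hxj : x ≠ j)
    (hxk : x ≠ k) (hij : i ≠ j) (hik : i ≠ k) (hjk : j ≠ k) (hj : v i ⨯₃ v j ⬝ᵥ v x = 0)
    (hk : v i ⨯₃ v k ⬝ᵥ v x = 0) : False := by
  refine hv.not_collinear hxi hxj hxk hij hik hjk ?_ ?_
  · rwa [cross_dot_rotate]
  · rwa [cross_dot_rotate]

/-- Try the line pairs `ab ∪ cd` and `ac ∪ bd`. If both contain `x`, then `x` lies on a line of each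
pair; these two lines share one of the four points, so `x` and three of the points are collinear. -/
theorem exists_conic_avoiding (hv : IsGeneric v) {x a b c d : ι} (hxa : x ≠ a) (hxb : x ≠ b)
    (hxc : x ≠ c) (hxd : x ≠ d) (hab : a ≠ b) (hac : a ≠ c) (had : a ≠ d) (hbc : b ≠ c)
    (hbd : b ≠ d) (hcd : c ≠ d) :
    ∃ Q : Form K 2, evalForm (v x) Q ≠ 0 ∧
      ∀ i ∈ ({a, b, c, d} : Finset ι), evalForm (v i) Q = 0 := by
  by_contra! hcon
  have key : ∀ {a b c d : ι}, v a ⨯₃ v b ⬝ᵥ v x ≠ 0 → v c ⨯₃ v d ⬝ᵥ v x ≠ 0 →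
      ∃ Q : Form K 2, evalForm (v x) Q ≠ 0 ∧
      ∀ i ∈ ({a, b, c, d} : Finset ι), evalForm (v i) Q = 0 := by
    intro a b c d h1 h2
    refine ⟨mulForm rfl (linForm (v a ⨯₃ v b)) (linForm (v c ⨯₃ v d)), ?_, ?_⟩
    · simp [h1, h2]
    · intro i hi
      simp only [Finset.mem_insert, Finset.mem_singleton] at hi
      rcases hi with rfl | rfl | rfl | rfl <;> simp
  have h1 : v a ⨯₃ v b ⬝ᵥ v x = 0 ∨ v c ⨯₃ v d ⬝ᵥ v x = 0 := by
    by_contra! h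
    obtain ⟨Q, hQ, hQ'⟩ := key h.1 h.2
    obtain ⟨i, hi, hi'⟩ := hcon Q hQ
    exact hi' (hQ' i hi)
  have h2 : v a ⨯₃ v c ⬝ᵥ v x = 0 ∨ v b ⨯₃ v d ⬝ᵥ v x = 0 := by
    by_contra! h
    obtain ⟨Q, hQ, hQ'⟩ := key h.1 h.2
    obtain ⟨i, hi, hi'⟩ := hcon Q hQ
    refine hi' (hQ' i ?_)
    simp only [Finset.mem_insert, Finset.mem_singleton] at hi ⊢
    tauto
  rcases h1 with h1 | h1 <;> rcases h2 with h2 | h2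
  · exact hv.not_collinear_of_line hxa hxb hxc hab hac hbc h1 h2
  · exact hv.not_collinear_of_line hxb hxa hxd hab.symm hbd had
      (by rwa [cross_dot_swap_left, neg_eq_zero]) h2
  · exact hv.not_collinear_of_line hxc hxd hxa hcd hac.symm had.symm h1
      (by rwa [cross_dot_swap_left, neg_eq_zero])
  · exact hv.not_collinear_of_line hxd hxc hxb hcd.symm hbd.symm hbc.symm
      (by rwa [cross_dot_swap_left, neg_eq_zero]) (by rwa [cross_dot_swap_left, neg_eq_zero])

/-- By `exists_conic_avoiding`, five points impose independent conditions on the 6-dimensional space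
of conics. -/
theorem conic_unique (hv : IsGeneric v) {s : Finset ι} (hs : s.card = 5) {Q Q' : Form K 2}
    (hQ : ∀ i ∈ s, evalForm (v i) Q = 0) (hQ' : ∀ i ∈ s, evalForm (v i) Q' = 0) (h0 : Q' ≠ 0) :
    ∃ c : K, Q = c • Q' := by
  suffices h : ∃ c, LinearMap.toSpanSingleton K (Form K 2) Q' c = Q from h.imp fun c hc => hc.symm
  refine exists_preimage_of_forall_eq_zero (ι := s) (fun i => evalForm (v i)) ?_ _ ?_ ?_ ?_
  · rintro ⟨x, hx⟩
    have hcard : (s.erase x).card = 4 := by rw [Finset.card_erase_of_mem hx, hs]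
    obtain ⟨a, b, c, d, hab, hac, had, hbc, hbd, hcd, he⟩ := Finset.card_eq_four.1 hcard
    have hne : ∀ y ∈ s.erase x, x ≠ y := fun y hy => (Finset.ne_of_mem_erase hy).symm
    obtain ⟨Q, hQ, hQ'⟩ := hv.exists_conic_avoiding (hne a (by simp [he])) (hne b (by simp [he]))
      (hne c (by simp [he])) (hne d (by simp [he])) hab hac had hbc hbd hcd
    refine ⟨Q, hQ, ?_⟩
    rintro ⟨j, hj⟩ hjx
    refine hQ' j ?_
    rw [← he]
    exact Finset.mem_erase.2 ⟨fun h => hjx (Subtype.ext h), hj⟩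
  · rintro ⟨i, hi⟩ e
    simpa using Or.inr (hQ' i hi)
  · rw [LinearMap.ker_toSpanSingleton K h0, finrank_bot, finrank_form, finrank_self,
      Fintype.card_coe, hs]
    decide
  · rintro ⟨i, hi⟩
    exact hQ i hi

end IsGeneric

theorem exists_form_ne_zero_of_card_lt {ι : Type*} (v : ι → Fin 3 → K) {d : ℕ}
    {s : Finset ι} (hs : s.card < (d + 2).choose 2) :
    ∃ Q : Form K d, Q ≠ 0 ∧ ∀ i ∈ s, evalForm (v i) Q = 0 := by
  have h := LinearMap.ker_ne_bot_of_finrank_lt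
    (f := LinearMap.pi fun i : s => evalForm (d := d) (v i))
    (by rwa [finrank_form, finrank_fintype_fun_eq_card, Fintype.card_coe])
  obtain ⟨Q, hQ, hQ0⟩ := Submodule.exists_mem_ne_zero_of_ne_bot h
  exact ⟨Q, hQ0, fun i hi => congrFun hQ ⟨i, hi⟩⟩

namespace IsGeneric

variable {v : Fin 8 → Fin 3 → K}

/-- Suppose every cubic through the other seven points contains `x`. For `b` off the line `ax`, a
conic through the five points other than `a`, `b`, `x`, multiplied by the line `ab`, shows that the
conic contains `x` too. Two choices of `b` give conics sharing five points, hence proportional, and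
so a conic through the seven points other than `a`. -/
theorem exists_cubic_avoiding (hv : IsGeneric v) (x : Fin 8) :
    ∃ c : Form K 3, evalForm (v x) c ≠ 0 ∧ ∀ i, i ≠ x → evalForm (v i) c = 0 := by
  classical
  obtain ⟨a, hax⟩ : ∃ a : Fin 8, a ≠ x := exists_ne x
  -- The remaining points on the line `ax`; there is at most one, so at least five choices of `b`
  -- are left.
  set bad : Finset (Fin 8) :=
    ((Finset.univ.erase x).erase a).filter fun b => v a ⨯₃ v x ⬝ᵥ v b = 0 with hbad
  have hbad1 : bad.card ≤ 1 := by
    have := hv.line _ (hv.cross_ne a x hax) (insert a (insert x bad)) (by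
      intro m hm
      simp only [Finset.mem_insert, hbad, Finset.mem_filter] at hm
      rcases hm with rfl | rfl | hm
      · exact cross_dot_self_left _ _
      · exact cross_dot_self_right _ _
      · exact hm.2)
    rw [Finset.card_insert_of_notMem (by simp [hbad, hax]),
      Finset.card_insert_of_notMem (by simp [hbad])] at this
    omega
  have hgood : 1 < (((Finset.univ.erase x).erase a) \ bad).card := by
    have h1 := Finset.le_card_sdiff bad ((Finset.univ.erase x).erase a)
    have h2 : ((Finset.univ.erase x).erase a).card = 6 := by
      rw [Finset.card_erase_of_mem (by simp [hax]), Finset.card_erase_of_mem (by simp)]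
      simp
    omega
  obtain ⟨b, hb, b', hb', hbb'⟩ := Finset.one_lt_card.1 hgood
  simp only [Finset.mem_sdiff, Finset.mem_erase, hbad, Finset.mem_filter, Finset.mem_univ,
    and_true, not_and] at hb hb'
  have hbx := hb.2 hb.1
  have hbx' := hb'.2 hb'.1
  by_contra! hcon
  have key : ∀ b : Fin 8, b ≠ a → b ≠ x → v a ⨯₃ v x ⬝ᵥ v b ≠ 0 →
      ∃ Q : Form K 2, Q ≠ 0 ∧ ∀ i, i ≠ a → i ≠ b → evalForm (v i) Q = 0 := by
    intro b hba hbx hb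
    obtain ⟨Q, hQ0, hQ⟩ := exists_form_ne_zero_of_card_lt (d := 2) v
      (s := ((Finset.univ.erase x).erase a).erase b) (by
        rw [Finset.card_erase_of_mem (by simp [hba, hbx]),
          Finset.card_erase_of_mem (by simp [hax]), Finset.card_erase_of_mem (by simp)]
        decide)
    refine ⟨Q, hQ0, fun i hia hib => ?_⟩
    by_cases hix : i = x
    · subst hix
      by_contra hne
      obtain ⟨j, hj, hj'⟩ := hcon (mulForm rfl (linForm (v a ⨯₃ v b)) Q) (by
        rw [evalForm_apply] at hne
        simp only [evalForm_apply, coe_mulForm, coe_linForm, map_mul, eval_lin]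
        refine mul_ne_zero hne fun h => hb ?_
        rwa [cross_dot_swap_right, neg_eq_zero] at h)
      apply hj'
      by_cases hja : j = a
      · subst hja
        simp
      by_cases hjb : j = b
      · subst hjb
        simp
      have := hQ j (by simp [*])
      rw [evalForm_apply] at this
      simp [this]
    · exact hQ i (by simp [*])
  obtain ⟨Q, hQ0, hQ⟩ := key b hb.1.1 hb.1.2 hbx
  obtain ⟨Q', hQ0', hQ'⟩ := key b' hb'.1.1 hb'.1.2 hbx'
  obtain ⟨c, hc⟩ := hv.conic_unique (s := ((Finset.univ.erase a).erase b).erase b') (Q := Q)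
    (Q' := Q') (by
      rw [Finset.card_erase_of_mem (by simp [hbb'.symm, hb'.1.1]),
          Finset.card_erase_of_mem (by simp [hb.1.1]), Finset.card_erase_of_mem (by simp)]
      simp) (by
      intro i hi
      simp only [Finset.mem_erase] at hi
      exact hQ i hi.2.2.1 hi.2.1) (by
      intro i hi
      simp only [Finset.mem_erase] at hi
      exact hQ' i hi.2.2.1 hi.1) hQ0'
  have := hv.quadric Q hQ0 (Finset.univ.erase a) (by
    intro i hi
    rw [← evalForm_apply]
    by_cases hib : i = b
    · subst hib
      rw [hc, map_smul, hQ' i (by simpa using hi) hbb', smul_zero]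
    · exact hQ i (by simpa using hi) hib)
  rw [Finset.card_erase_of_mem (by simp)] at this
  simp at this

end IsGeneric

end Configuration

/-! ### The pencil of cubics through eight points -/

section Pencil

variable {K : Type*} [Field K]

/-- Two independent cubics through eight points in general position. -/
structure IsPencil (v : Fin 8 → Fin 3 → K) (q r : Form K 3) : Prop where
  generic : IsGeneric v
  indep : LinearIndependent K ![q, r]
  vanish_left : ∀ i, eval (v i) (q : MvPolynomial (Fin 3) K) = 0
  vanish_right : ∀ i, eval (v i) (r : MvPolynomial (Fin 3) K) = 0

theorem IsGeneric.exists_isPencil {v : Fin 8 → Fin 3 → K} (hv : IsGeneric v) :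
    ∃ q r, IsPencil v q r := by
  have h := finrank_ker_pi_add_card (fun i => evalForm (d := 3) (v i)) hv.exists_cubic_avoiding
  rw [finrank_form, Fintype.card_fin, show Nat.choose (3 + 2) 2 = 10 by decide] at h
  obtain ⟨q, hq, r, hr, hqr⟩ := exists_linearIndependent_pair_mem (show 1 < finrank K
    (LinearMap.ker (LinearMap.pi fun i => evalForm (d := 3) (v i))) by omega)
  refine ⟨q, r, hv, hqr, fun i => ?_, fun i => ?_⟩
  · simpa using congrFun (LinearMap.mem_ker.1 hq) i
  · simpa using congrFun (LinearMap.mem_ker.1 hr) i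

namespace IsPencil

variable {v : Fin 8 → Fin 3 → K} {q r : Form K 3}

theorem left_ne_zero (h : IsPencil v q r) : (q : MvPolynomial (Fin 3) K) ≠ 0 := fun h0 =>
  h.indep.ne_zero 0 (Subtype.ext h0)

theorem right_ne_zero (h : IsPencil v q r) : (r : MvPolynomial (Fin 3) K) ≠ 0 := fun h0 =>
  h.indep.ne_zero 1 (Subtype.ext h0)

theorem not_proportional (h : IsPencil v q r) {g a b : MvPolynomial (Fin 3) K}
    (hq : (q : MvPolynomial (Fin 3) K) = g * a) (hr : (r : MvPolynomial (Fin 3) K) = g * b)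
    {s t : K} (hst : s • a = t • b) : s = 0 := by
  refine (LinearIndependent.pair_iff.1 h.indep s (-t) (Subtype.ext ?_)).1
  simp only [neg_smul, Submodule.coe_add, Submodule.coe_smul, Submodule.coe_neg, hq, hr]
  rw [← mul_smul_comm, hst, ← mul_smul_comm, add_neg_cancel]
  rfl

/-- A common line contains at most three of the points, so the residual conics share five and are
proportional. A common conic contains at most six, so the residual lines share two and coincide. A
common cubic makes `q` and `r` proportional outright. -/
theorem no_common_factor (h : IsPencil v q r) {g a b : MvPolynomial (Fin 3) K} {e d : ℕ}
    (he : e + d = 3) (hg : g.IsHomogeneous e) (ha : a.IsHomogeneous d) (hb : b.IsHomogeneous d)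
    (hq : (q : MvPolynomial (Fin 3) K) = g * a) (hr : (r : MvPolynomial (Fin 3) K) = g * b) :
    e = 0 := by
  classical
  have hv := h.generic
  have hg0 : g ≠ 0 := by rintro rfl; exact h.left_ne_zero (by simpa using hq)
  have ha0 : a ≠ 0 := by rintro rfl; exact h.left_ne_zero (by simpa using hq)
  have hb0 : b ≠ 0 := by rintro rfl; exact h.right_ne_zero (by simpa using hr)
  set s : Finset (Fin 8) := Finset.univ.filter fun i => eval (v i) g = 0 with hs
  have hcompl : ∀ i ∈ sᶜ, eval (v i) a = 0 ∧ eval (v i) b = 0 := by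
    intro i hi
    have hi' : eval (v i) g ≠ 0 := by simpa [hs] using hi
    have h1 := h.vanish_left i
    have h2 := h.vanish_right i
    rw [hq, map_mul] at h1
    rw [hr, map_mul] at h2
    exact ⟨(mul_eq_zero.1 h1).resolve_left hi', (mul_eq_zero.1 h2).resolve_left hi'⟩
  have hcard := Finset.card_add_card_compl s
  rw [Fintype.card_fin] at hcard
  obtain rfl | rfl | rfl | rfl : e = 0 ∨ e = 1 ∨ e = 2 ∨ e = 3 := by omega
  · rfl
  · exfalso
    obtain rfl : d = 2 := by omega
    obtain ⟨l, rfl⟩ := exists_eq_lin hg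
    have hlt : s.card < 4 := by
      refine hv.line l ?_ s fun i hi => ?_
      · rintro rfl
        exact hg0 (by simp [lin])
      · simpa [hs] using hi
    obtain ⟨t, hts, ht⟩ := Finset.exists_subset_card_eq (show 5 ≤ sᶜ.card by omega)
    obtain ⟨c, hc⟩ := hv.conic_unique ht (Q := ⟨a, ha⟩) (Q' := ⟨b, hb⟩)
      (fun i hi => by simpa using (hcompl i (hts hi)).1)
      (fun i hi => by simpa using (hcompl i (hts hi)).2) (fun h0 => hb0 (congrArg Subtype.val h0))
    have hc' : (1 : K) • a = c • b := by
      rw [one_smul]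
      exact congrArg Subtype.val hc
    exact one_ne_zero (h.not_proportional hq hr hc')
  · exfalso
    obtain rfl : d = 1 := by omega
    have hlt : s.card < 7 := by
      refine hv.quadric ⟨g, hg⟩ (fun h0 => hg0 (congrArg Subtype.val h0)) s fun i hi => ?_
      simpa [hs] using hi
    obtain ⟨i, hi, j, hj, hij⟩ := Finset.one_lt_card.1 (show 1 < sᶜ.card by omega)
    obtain ⟨l, rfl⟩ := exists_eq_lin ha
    obtain ⟨m, rfl⟩ := exists_eq_lin hb
    have hi' := hcompl i hi
    have hj' := hcompl j hj
    simp only [eval_lin] at hi' hj'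
    have hx := hv.cross_ne i j hij
    obtain ⟨c, hc⟩ := exists_smul_cross (w := l) hx (by rw [dotProduct_comm]; exact hi'.1)
      (by rw [dotProduct_comm]; exact hj'.1)
    obtain ⟨d, hd⟩ := exists_smul_cross (w := m) hx (by rw [dotProduct_comm]; exact hi'.2)
      (by rw [dotProduct_comm]; exact hj'.2)
    have hd0 : d = 0 := h.not_proportional hq hr (s := d) (t := c) (by
      rw [← lin_smul, ← lin_smul, hc, hd, smul_comm])
    exact hb0 (by simp [hd, hd0, lin])
  · exfalso
    obtain rfl : d = 0 := by omega
    rw [← totalDegree_zero_iff_isHomogeneous, totalDegree_eq_zero_iff_eq_C] at ha hb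
    have h0 : coeff 0 b = 0 := h.not_proportional hq hr (s := coeff 0 b) (t := coeff 0 a) (by
      rw [smul_eq_C_mul, smul_eq_C_mul, ← hb, ← ha, mul_comm])
    rw [h0, C_0] at hb
    exact hb0 hb

/-- A common factor is not known to be homogeneous, so it and its cofactors are replaced by their
top-degree components. -/
theorem isRelPrime (h : IsPencil v q r) :
    IsRelPrime (q : MvPolynomial (Fin 3) K) (r : MvPolynomial (Fin 3) K) := by
  rintro g ⟨a, ha⟩ ⟨b, hb⟩
  have hg0 : g ≠ 0 := by rintro rfl; exact h.left_ne_zero (by simpa using ha)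
  have ha0 : a ≠ 0 := by rintro rfl; exact h.left_ne_zero (by simpa using ha)
  have hb0 : b ≠ 0 := by rintro rfl; exact h.right_ne_zero (by simpa using hb)
  have h1 := q.isHomogeneous.totalDegree h.left_ne_zero
  have h2 := r.isHomogeneous.totalDegree h.right_ne_zero
  rw [ha, totalDegree_mul_of_isDomain hg0 ha0] at h1
  rw [hb, totalDegree_mul_of_isDomain hg0 hb0] at h2
  have hd : b.totalDegree = a.totalDegree := by omega
  refine isUnit_of_totalDegree_eq_zero hg0 (h.no_common_factor h1
    (homogeneousComponent_isHomogeneous g.totalDegree g)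
    (homogeneousComponent_isHomogeneous a.totalDegree a)
    (homogeneousComponent_isHomogeneous a.totalDegree b) ?_ ?_)
  · rw [← homogeneousComponent_mul_of_totalDegree_le le_rfl le_rfl, ← ha, h1,
      homogeneousComponent_eq_self q.isHomogeneous]
  · rw [← homogeneousComponent_mul_of_totalDegree_le le_rfl hd.le, ← hb, h1,
      homogeneousComponent_eq_self r.isHomogeneous]

theorem exists_syzygy (h : IsPencil v q r) {A B : MvPolynomial (Fin 3) K}
    (hAB : A * q + B * r = 0) : ∃ t, A = -(t * r) ∧ B = t * q := by
  have hdvd : (q : MvPolynomial (Fin 3) K) ∣ B * r :=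
    ⟨-A, by linear_combination hAB⟩
  obtain ⟨t, rfl⟩ := h.isRelPrime.dvd_of_dvd_mul_right hdvd
  refine ⟨t, ?_, mul_comm _ _⟩
  apply mul_right_cancel₀ h.left_ne_zero
  linear_combination hAB

theorem syzygy_eq_zero (h : IsPencil v q r) {A B : MvPolynomial (Fin 3) K}
    {d : ℕ} (hd : d ≤ 2) (hB : B.IsHomogeneous d) (hAB : A * q + B * r = 0) : A = 0 ∧ B = 0 := by
  obtain ⟨t, hA, ht⟩ := h.exists_syzygy hAB
  have h0 : t = 0 := by
    by_contra h0
    have h1 := totalDegree_mul_of_isDomain h0 h.left_ne_zero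
    rw [← ht, q.isHomogeneous.totalDegree h.left_ne_zero] at h1
    have := hB.totalDegree_le
    omega
  simp [hA, ht, h0]

theorem exists_syzygy_const (h : IsPencil v q r) {A B : MvPolynomial (Fin 3) K}
    (hB : B.IsHomogeneous 3) (hAB : A * q + B * r = 0) :
    ∃ c : K, A = -(c • (r : MvPolynomial (Fin 3) K)) ∧ B = c • (q : MvPolynomial (Fin 3) K) := by
  obtain ⟨t, hA, ht⟩ := h.exists_syzygy hAB
  have h0 : t.totalDegree = 0 := by
    by_cases h0 : t = 0
    · simp [h0]
    have h1 := totalDegree_mul_of_isDomain h0 h.left_ne_zero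
    rw [← ht, q.isHomogeneous.totalDegree h.left_ne_zero] at h1
    have := hB.totalDegree_le
    omega
  rw [totalDegree_eq_zero_iff_eq_C] at h0
  refine ⟨coeff 0 t, ?_, ?_⟩
  · rw [smul_eq_C_mul, ← h0, hA]
  · rw [smul_eq_C_mul, ← h0, ht]

end IsPencil

/-- The multiplication map `(A, B) ↦ A * q + B * r`. -/
def pencilMap {d n : ℕ} (h : d + 3 = n) (q r : Form K 3) : Form K d × Form K d →ₗ[K] Form K n :=
  (mulForm h q).coprod (mulForm h r)

@[simp] theorem coe_pencilMap {d n : ℕ} (h : d + 3 = n) (q r : Form K 3) (e : Form K d × Form K d) :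
    (pencilMap h q r e : MvPolynomial (Fin 3) K) = e.1 * q + e.2 * r := rfl

namespace IsPencil

variable {v : Fin 8 → Fin 3 → K} {q r : Form K 3}

theorem ker_pencilMap (h : IsPencil v q r) {d n : ℕ} (hn : d + 3 = n) (hd : d ≤ 2) :
    LinearMap.ker (pencilMap hn q r) = ⊥ := by
  rw [LinearMap.ker_eq_bot']
  intro e he
  obtain ⟨h1, h2⟩ := h.syzygy_eq_zero hd e.2.isHomogeneous (congrArg Subtype.val he)
  exact Prod.ext (Subtype.ext h1) (Subtype.ext h2)

theorem finrank_ker_pencilMap_three (h : IsPencil v q r) :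
    finrank K (LinearMap.ker (pencilMap (d := 3) (n := 6) rfl q r)) ≤ 1 := by
  have hle : LinearMap.ker (pencilMap (d := 3) (n := 6) rfl q r) ≤
      K ∙ ((-r, q) : Form K 3 × Form K 3) := by
    intro e he
    obtain ⟨c, h1, h2⟩ := h.exists_syzygy_const e.2.isHomogeneous
      (congrArg Subtype.val (LinearMap.mem_ker.1 he))
    refine Submodule.mem_span_singleton.2 ⟨c, Prod.ext (Subtype.ext ?_) (Subtype.ext ?_)⟩
    · simpa using h1.symm
    · simpa using h2.symm
  refine (Submodule.finrank_mono hle).trans (finrank_span_singleton fun h0 => ?_).le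
  exact h.left_ne_zero (congrArg Subtype.val (Prod.ext_iff.1 h0).2)

/-- Cubics through the eight points belong to the pencil. -/
theorem exists_cubic_eq (h : IsPencil v q r) {f : Form K 3}
    (hf : ∀ i, eval (v i) (f : MvPolynomial (Fin 3) K) = 0) : ∃ s t : K, f = s • q + t • r := by
  suffices H : ∃ e, ((LinearMap.toSpanSingleton K _ q).coprod (LinearMap.toSpanSingleton K _ r)) e
      = f from by
    obtain ⟨e, he⟩ := H
    exact ⟨e.1, e.2, he.symm⟩
  refine exists_preimage_of_forall_eq_zero (fun i => evalForm (v i))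
    h.generic.exists_cubic_avoiding _ ?_ ?_ ?_
  · intro i e
    simp [h.vanish_left i, h.vanish_right i]
  · have hker : LinearMap.ker ((LinearMap.toSpanSingleton K _ q).coprod
        (LinearMap.toSpanSingleton K _ r)) = ⊥ := by
      rw [LinearMap.ker_eq_bot']
      intro e he
      exact Prod.ext_iff.2 (LinearIndependent.pair_iff.1 h.indep e.1 e.2 he)
    rw [hker, finrank_bot, finrank_form, finrank_prod, finrank_self, Fintype.card_fin]
    decide
  · simpa using hf

end IsPencil

end Pencil

/-! ### The residual point -/

section Residual

variable {K : Type*} [Field K]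

theorem exists_dual {V ι : Type*} [AddCommGroup V] [Module K V] [DecidableEq ι]
    (φ : ι → V →ₗ[K] K) (hs : ∀ i, ∃ s, φ i s ≠ 0 ∧ ∀ j, j ≠ i → φ j s = 0) :
    ∃ s : ι → V, ∀ i j, φ i (s j) = if i = j then 1 else 0 := by
  choose s hs0 hs1 using hs
  refine ⟨fun i => (φ i (s i))⁻¹ • s i, fun i j => ?_⟩
  split_ifs with hij
  · subst hij
    simp [hs0 i]
  · simp [hs1 j i hij]

theorem exists_form_avoiding_succ {ι : Type*} {v : ι → Fin 3 → K} (hv : ∀ i, v i ≠ 0) {d : ℕ}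
    (h : ∀ x, ∃ c : Form K d, evalForm (v x) c ≠ 0 ∧ ∀ i, i ≠ x → evalForm (v i) c = 0) (x : ι) :
    ∃ c : Form K (d + 1), evalForm (v x) c ≠ 0 ∧ ∀ i, i ≠ x → evalForm (v i) c = 0 := by
  obtain ⟨c, hc, hc'⟩ := h x
  obtain ⟨l, hl⟩ := exists_dot_ne_zero (hv x)
  simp only [evalForm_apply] at hc hc'
  exact ⟨mulForm rfl (linForm l) c, by simp [hc, hl], fun i hi => by simp [hc' i hi]⟩

theorem aeval_smul_of_isHomogeneous {L : Type*} [Field L] [Algebra K L]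
    {f : MvPolynomial (Fin 3) K} {n : ℕ} (hf : f.IsHomogeneous n) (c : L) (w : Fin 3 → L) :
    aeval (c • w) f = c ^ n * aeval w f := by
  rw [aeval_def, aeval_def, eval₂_eq', eval₂_eq', Finset.mul_sum]
  refine Finset.sum_congr rfl fun m hm => ?_
  have hdeg := hf (mem_support_iff.1 hm)
  rw [Finsupp.weight_apply, Finsupp.sum_fintype _ _ (by simp)] at hdeg
  simp only [Pi.smul_apply, smul_eq_mul, mul_pow, Finset.prod_mul_distrib,
    Finset.prod_pow_eq_pow_sum]
  rw [← hdeg]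
  simp only [Pi.one_apply, smul_eq_mul, mul_one]
  ring

theorem aeval_algebraMap_comp {L : Type*} [Field L] [Algebra K L]
    (f : MvPolynomial (Fin 3) K) (x : Fin 3 → K) :
    aeval (fun i => algebraMap K L (x i)) f = algebraMap K L (eval x f) :=
  aeval_algebraMap_apply L x f |>.trans (by rw [aeval_eq_eval])

/-- The gradient of a polynomial at a vector over an extension field. -/
def grad {L : Type*} [Field L] [Algebra K L] (w : Fin 3 → L) (f : MvPolynomial (Fin 3) K) :
    Fin 3 → L := fun i => aeval w (pderiv i f)

section Grad

variable {L : Type*} [Field L] [Algebra K L] (w : Fin 3 → L)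

theorem grad_add (f g : MvPolynomial (Fin 3) K) : grad w (f + g) = grad w f + grad w g := by
  ext i
  simp [grad]

theorem grad_sub (f g : MvPolynomial (Fin 3) K) : grad w (f - g) = grad w f - grad w g := by
  ext i
  simp [grad]

theorem grad_smul (c : K) (f : MvPolynomial (Fin 3) K) :
    grad w (c • f) = algebraMap K L c • grad w f := by
  ext i
  simp [grad, Algebra.smul_def]

theorem grad_mul (f g : MvPolynomial (Fin 3) K) :
    grad w (f * g) = aeval w f • grad w g + aeval w g • grad w f := by
  ext i
  simp [grad, Derivation.leibniz]

theorem grad_lin (l : Fin 3 → K) : grad w (lin l) = fun i => algebraMap K L (l i) := by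
  ext i
  simp [grad, pderiv_lin]

theorem cross_map (a b : Fin 3 → K) :
    (fun i => algebraMap K L (a i)) ⨯₃ (fun i => algebraMap K L (b i)) =
      fun i => algebraMap K L ((a ⨯₃ b) i) := by
  ext i
  fin_cases i <;> simp [cross_apply]

theorem cross_map_ne_zero {a b : Fin 3 → K} (h : a ⨯₃ b ≠ 0) :
    (fun i => algebraMap K L (a i)) ⨯₃ (fun i => algebraMap K L (b i)) ≠ 0 := by
  rw [cross_map]
  intro h0
  apply h
  ext i
  simpa using congrFun h0 i

theorem dot_map (a b : Fin 3 → K) :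
    (fun i => algebraMap K L (a i)) ⬝ᵥ (fun i => algebraMap K L (b i)) =
      algebraMap K L (a ⬝ᵥ b) := by
  simp [dotProduct]

end Grad

theorem cross_eq_zero_of_smul_add {a b : Fin 3 → K} {s t : K} (h : s • a + t • b = 0)
    (hst : s ≠ 0 ∨ t ≠ 0) : a ⨯₃ b = 0 := by
  rcases hst with hs | ht
  · refine (smul_eq_zero.1 (?_ : s • (a ⨯₃ b) = 0)).resolve_left hs
    rw [← LinearMap.smul_apply, ← map_smul, eq_neg_of_add_eq_zero_left h]
    simp
  · refine (smul_eq_zero.1 (?_ : t • (a ⨯₃ b) = 0)).resolve_left ht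
    rw [← map_smul, eq_neg_of_add_eq_zero_right h]
    simp

theorem exists_eq_lin_mul {l : Fin 3 → K} (hl : l ≠ 0) {d : ℕ} {A : MvPolynomial (Fin 3) K}
    (hA : A.IsHomogeneous (d + 1)) (hdvd : lin l ∣ A) :
    ∃ A₀ : MvPolynomial (Fin 3) K, A₀.IsHomogeneous d ∧ A = lin l * A₀ := by
  obtain ⟨t, rfl⟩ := hdvd
  refine ⟨homogeneousComponent d t, homogeneousComponent_isHomogeneous _ _, ?_⟩
  have ht : t.totalDegree ≤ d := by
    by_cases h0 : t = 0
    · simp [h0]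
    have h1 := totalDegree_mul_of_isDomain (lin_ne_zero hl) h0
    rw [(lin_isHomogeneous l).totalDegree (lin_ne_zero hl)] at h1
    have := hA.totalDegree_le
    omega
  have h1 := homogeneousComponent_mul_of_totalDegree_le (lin_isHomogeneous l).totalDegree_le ht
  rwa [add_comm 1 d, homogeneousComponent_eq_self hA,
    homogeneousComponent_eq_self (lin_isHomogeneous l)] at h1

/-- Since `lin l` is prime and does not divide `lin m`, it divides `A` and `B` and can be cancelled.
-/
theorem exists_eq_of_lin_mul_eq {l m : Fin 3 → K} (hlm : l ⨯₃ m ≠ 0) {d : ℕ}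
    {F q r A B A' B' : MvPolynomial (Fin 3) K} (hA : A.IsHomogeneous (d + 1))
    (hB : B.IsHomogeneous (d + 1)) (hl : lin l * F = A * q + B * r)
    (hAA : lin m * A = lin l * A') (hBB : lin m * B = lin l * B') :
    ∃ A₀ B₀ : MvPolynomial (Fin 3) K, A₀.IsHomogeneous d ∧ B₀.IsHomogeneous d ∧
      F = A₀ * q + B₀ * r := by
  have hl0 : l ≠ 0 := by
    rintro rfl
    simp at hlm
  have hp := (lin_irreducible hl0).prime
  have hnd := lin_not_dvd_lin hlm
  obtain ⟨A₀, hA₀, rfl⟩ := exists_eq_lin_mul hl0 hA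
    ((hp.dvd_or_dvd (Dvd.intro _ hAA.symm)).resolve_left hnd)
  obtain ⟨B₀, hB₀, rfl⟩ := exists_eq_lin_mul hl0 hB
    ((hp.dvd_or_dvd (Dvd.intro _ hBB.symm)).resolve_left hnd)
  refine ⟨A₀, B₀, hA₀, hB₀, mul_left_cancel₀ (lin_ne_zero hl0) ?_⟩
  rw [hl]
  ring

/-- A quartic through the eight points outside the ideal of the pencil, together with two linear
forms that multiply it into that ideal. -/
structure IsResidual (v : Fin 8 → Fin 3 → K) (q r : Form K 3) (F : Form K 4) (l m : Fin 3 → K)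
    (A B A' B' : Form K 2) : Prop where
  pencil : IsPencil v q r
  vanish : ∀ i, eval (v i) (F : MvPolynomial (Fin 3) K) = 0
  not_mem : F ∉ LinearMap.range (pencilMap (d := 1) (n := 4) rfl q r)
  cross_ne : l ⨯₃ m ≠ 0
  mul_left : lin l * (F : MvPolynomial (Fin 3) K) = A * q + B * r
  mul_right : lin m * (F : MvPolynomial (Fin 3) K) = A' * q + B' * r

theorem IsGeneric.ne_zero {v : Fin 8 → Fin 3 → K} (hv : IsGeneric v) (i : Fin 8) : v i ≠ 0 := by
  intro h0
  obtain ⟨j, hj⟩ := exists_ne i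
  exact hv.cross_ne i j hj.symm (by simp [h0])

/-- Quartics through the points have dimension `15 - 8 = 7`, while `(q, r)` has dimension `6` in
degree `4`; this gives `F`. -/
theorem IsPencil.exists_isResidual {v : Fin 8 → Fin 3 → K} {q r : Form K 3}
    (h : IsPencil v q r) : ∃ F l m A B A' B', IsResidual v q r F l m A B A' B' := by
  have h4 : ∀ x, ∃ c : Form K 4, evalForm (v x) c ≠ 0 ∧ ∀ i, i ≠ x → evalForm (v i) c = 0 :=
    exists_form_avoiding_succ h.generic.ne_zero h.generic.exists_cubic_avoiding
  have h5 : ∀ x, ∃ c : Form K 5, evalForm (v x) c ≠ 0 ∧ ∀ i, i ≠ x → evalForm (v i) c = 0 :=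
    exists_form_avoiding_succ h.generic.ne_zero h4
  obtain ⟨F, hF, hF'⟩ : ∃ F ∈ LinearMap.ker (LinearMap.pi fun i => evalForm (d := 4) (v i)),
      F ∉ LinearMap.range (pencilMap (d := 1) (n := 4) rfl q r) := by
    rw [← SetLike.not_le_iff_exists]
    intro hle
    have h1 := finrank_ker_pi_add_card _ h4
    have h2 := LinearMap.finrank_range_add_finrank_ker (pencilMap (d := 1) (n := 4) rfl q r)
    rw [h.ker_pencilMap rfl (by norm_num), finrank_bot, finrank_prod, finrank_form,
      show Nat.choose (1 + 2) 2 = 3 by decide] at h2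
    rw [finrank_form, Fintype.card_fin, show Nat.choose (4 + 2) 2 = 15 by decide] at h1
    have h3 := Submodule.finrank_mono hle
    omega
  have hFv : ∀ i, eval (v i) (F : MvPolynomial (Fin 3) K) = 0 := fun i => by
    simpa using congrFun (LinearMap.mem_ker.1 hF) i
  -- A source of dimension `3 + 12 = 15` maps into the quintics through the points, of dimension `21
  -- - 8 = 13`, so the kernel has dimension at least `2`.
  set T : (Fin 3 → K) × (Form K 2 × Form K 2) →ₗ[K] Form K 5 :=
    ((mulForm rfl F) ∘ₗ linForm).coprod (-pencilMap rfl q r) with hT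
  have hker := finrank_add_card_le_finrank_ker_add _ h5 T (by
    intro i e
    simp [hT, hFv i, h.vanish_left i, h.vanish_right i])
  rw [finrank_prod, finrank_prod, finrank_form, finrank_form, finrank_fintype_fun_eq_card,
    Fintype.card_fin, Fintype.card_fin, show Nat.choose (2 + 2) 2 = 6 by decide,
    show Nat.choose (5 + 2) 2 = 21 by decide] at hker
  obtain ⟨x, hx, y, hy, hxy⟩ := exists_linearIndependent_pair_mem
    (show 1 < finrank K (LinearMap.ker T) by omega)
  have hTe : ∀ e ∈ LinearMap.ker T, lin e.1 * (F : MvPolynomial (Fin 3) K) =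
      e.2.1 * q + e.2.2 * r := by
    intro e he
    have := congrArg Subtype.val (LinearMap.mem_ker.1 he)
    simp only [hT, LinearMap.coprod_apply, LinearMap.comp_apply, LinearMap.neg_apply,
      Submodule.coe_add, Submodule.coe_neg, coe_mulForm, coe_linForm, coe_pencilMap] at this
    exact add_neg_eq_zero.1 this
  refine ⟨F, x.1, y.1, x.2.1, x.2.2, y.2.1, y.2.2, h, hFv, hF', ?_, hTe x hx, hTe y hy⟩
  rw [crossProduct_ne_zero_iff_linearIndependent, LinearIndependent.pair_iff]
  intro s t hst
  have he := hTe _ (Submodule.add_mem _ (Submodule.smul_mem _ s hx) (Submodule.smul_mem _ t hy))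
  have h1 : (s • x + t • y).1 = 0 := hst
  rw [h1] at he
  obtain ⟨h2, h3⟩ := h.syzygy_eq_zero (d := 2) le_rfl (Form.isHomogeneous _)
    (by rw [← he]; simp [lin])
  exact LinearIndependent.pair_iff.1 hxy s t
    (Prod.ext h1 (Prod.ext (Subtype.ext h2) (Subtype.ext h3)))

namespace IsResidual

variable {v : Fin 8 → Fin 3 → K} {q r : Form K 3} {F : Form K 4} {l m : Fin 3 → K}
  {A B A' B' : Form K 2}

/-- Computing `l m F` in two ways gives a syzygy of degree `3`, a constant multiple of the Koszul
one. If the constant vanished, `l` could be cancelled and `F` would lie in `(q, r)`. -/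
theorem exists_syzygy (h : IsResidual v q r F l m A B A' B') : ∃ c : K, c ≠ 0 ∧
    lin m * (A : MvPolynomial (Fin 3) K) - lin l * A' = -(c • (r : MvPolynomial (Fin 3) K)) ∧
    lin m * (B : MvPolynomial (Fin 3) K) - lin l * B' = c • (q : MvPolynomial (Fin 3) K) := by
  obtain ⟨c, h1, h2⟩ := h.pencil.exists_syzygy_const
    (A := lin m * (A : MvPolynomial (Fin 3) K) - lin l * A')
    (B := lin m * (B : MvPolynomial (Fin 3) K) - lin l * B')
    (((lin_isHomogeneous m).mul B.isHomogeneous).sub ((lin_isHomogeneous l).mul B'.isHomogeneous))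
    (by linear_combination lin l * h.mul_right - lin m * h.mul_left)
  refine ⟨c, ?_, h1, h2⟩
  rintro rfl
  rw [zero_smul, neg_zero, sub_eq_zero] at h1
  rw [zero_smul, sub_eq_zero] at h2
  obtain ⟨A₀, B₀, hA₀, hB₀, hF⟩ := exists_eq_of_lin_mul_eq h.cross_ne (d := 1) A.isHomogeneous
    B.isHomogeneous h.mul_left h1 h2
  exact h.not_mem ⟨(⟨A₀, hA₀⟩, ⟨B₀, hB₀⟩), Subtype.ext hF.symm⟩

theorem eval_left (h : IsResidual v q r F l m A B A' B') :
    eval (l ⨯₃ m) (q : MvPolynomial (Fin 3) K) = 0 := by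
  obtain ⟨c, hc, -, h2⟩ := h.exists_syzygy
  have := congrArg (eval (l ⨯₃ m)) h2
  simpa [hc, smul_eval] using this

theorem eval_right (h : IsResidual v q r F l m A B A' B') :
    eval (l ⨯₃ m) (r : MvPolynomial (Fin 3) K) = 0 := by
  obtain ⟨c, hc, h1, -⟩ := h.exists_syzygy
  have := congrArg (eval (l ⨯₃ m)) h1
  simpa [hc, smul_eval] using this

/-- At this point `l`, `m` and `F` all vanish, so differentiating `l F = A q + B r` and `m F = A' q
+ B' r` gives linear relations between the two gradients. If all coefficients vanish there,
differentiating `m B - l B' = c q` shows that the gradient of `q` is zero. -/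
theorem cross_grad_eq_zero (h : IsResidual v q r F l m A B A' B') {i : Fin 8}
    (hi : SamePoint (v i) (l ⨯₃ m)) :
    grad (l ⨯₃ m) (q : MvPolynomial (Fin 3) K) ⨯₃ grad (l ⨯₃ m) (r : MvPolynomial (Fin 3) K)
      = 0 := by
  obtain ⟨c, hc, h1, h2⟩ := h.exists_syzygy
  have hF : aeval (l ⨯₃ m) (F : MvPolynomial (Fin 3) K) = 0 := by
    obtain ⟨c, -, hc⟩ := hi
    rw [hc, aeval_smul_of_isHomogeneous F.isHomogeneous, aeval_eq_eval]
    simp [h.vanish i]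
  have hq := h.eval_left
  have hr := h.eval_right
  rw [← aeval_eq_eval] at hq hr
  have hl : aeval (l ⨯₃ m) (lin l) = 0 := by simp [aeval_eq_eval]
  have hm : aeval (l ⨯₃ m) (lin m) = 0 := by simp [aeval_eq_eval]
  have g1 := congrArg (grad (l ⨯₃ m)) h.mul_left
  have g2 := congrArg (grad (l ⨯₃ m)) h.mul_right
  have g3 := congrArg (grad (l ⨯₃ m)) h2
  simp only [grad_add, grad_mul, grad_sub, grad_smul, hF, hq, hr, hl, hm, zero_smul, zero_add,
    add_zero] at g1 g2 g3
  by_cases hA : aeval (l ⨯₃ m) (A : MvPolynomial (Fin 3) K) ≠ 0 ∨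
      aeval (l ⨯₃ m) (B : MvPolynomial (Fin 3) K) ≠ 0
  · exact cross_eq_zero_of_smul_add g1.symm hA
  by_cases hA' : aeval (l ⨯₃ m) (A' : MvPolynomial (Fin 3) K) ≠ 0 ∨
      aeval (l ⨯₃ m) (B' : MvPolynomial (Fin 3) K) ≠ 0
  · exact cross_eq_zero_of_smul_add g2.symm hA'
  push Not at hA hA'
  simp only [hA.2, hA'.2, zero_smul, sub_zero] at g3
  have : grad (l ⨯₃ m) (q : MvPolynomial (Fin 3) K) = 0 :=
    (smul_eq_zero.1 g3.symm).resolve_left (by simpa using hc)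
  simp [this]

/-- Quartics through the eight points. -/
theorem exists_quartic_eq (h : IsResidual v q r F l m A B A' B') {f : Form K 4}
    (hf : ∀ i, evalForm (v i) f = 0) :
    ∃ (s : K) (a b : Form K 1), (f : MvPolynomial (Fin 3) K) = s • (F : MvPolynomial (Fin 3) K) +
      (a * q + b * r) := by
  suffices H : ∃ e, ((LinearMap.toSpanSingleton K _ F).coprod
      (pencilMap (d := 1) (n := 4) rfl q r)) e = f from by
    obtain ⟨e, rfl⟩ := H
    exact ⟨e.1, e.2.1, e.2.2, rfl⟩
  refine exists_preimage_of_forall_eq_zero (fun i => evalForm (v i))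
    (exists_form_avoiding_succ h.pencil.generic.ne_zero h.pencil.generic.exists_cubic_avoiding)
    _ ?_ ?_ hf
  · intro i e
    simp [h.vanish i, h.pencil.vanish_left i, h.pencil.vanish_right i]
  · have hker : LinearMap.ker ((LinearMap.toSpanSingleton K _ F).coprod
        (pencilMap (d := 1) (n := 4) rfl q r)) = ⊥ := by
      rw [LinearMap.ker_eq_bot']
      rintro ⟨s, e⟩ he
      simp only [LinearMap.coprod_apply, LinearMap.toSpanSingleton_apply] at he
      have hs : s = 0 := by
        by_contra hs
        apply h.not_mem
        refine ⟨-(s⁻¹ • e), ?_⟩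
        rw [map_neg, map_smul, neg_eq_iff_eq_neg, inv_smul_eq_iff₀ hs, smul_neg]
        exact (neg_eq_of_add_eq_zero_right he).symm
      rw [hs, zero_smul, zero_add] at he
      have : e ∈ LinearMap.ker (pencilMap (d := 1) (n := 4) rfl q r) := he
      rw [h.pencil.ker_pencilMap rfl (by norm_num)] at this
      rw [hs, (Submodule.mem_bot K).1 this]
      rfl
    rw [hker, finrank_bot, finrank_form, finrank_prod, finrank_prod, finrank_self, finrank_form,
      Fintype.card_fin]
    decide

end IsResidual

end Residual

/-! ### Uniqueness of the residual point -/

section Uniqueness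

variable {K : Type*} [Field K] {v : Fin 8 → Fin 3 → K} {q r : Form K 3}

theorem IsPencil.cubic_decomposition (h : IsPencil v q r) {c : Fin 8 → Form K 3}
    (hc : ∀ i j, evalForm (v i) (c j) = if i = j then 1 else 0) (f : Form K 3) :
    ∃ s t : K, f = ∑ i, evalForm (v i) f • c i + (s • q + t • r) := by
  obtain ⟨s, t, hst⟩ := h.exists_cubic_eq (f := f - ∑ i, evalForm (v i) f • c i) (by
    intro i
    rw [← evalForm_apply, map_sub, map_sum]
    simp only [map_smul, hc, smul_eq_mul, mul_ite, mul_one, mul_zero, Finset.sum_ite_eq,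
      Finset.mem_univ, if_true, sub_self])
  exact ⟨s, t, by rw [← hst, add_sub_cancel]⟩

variable {L : Type*} [Field L] [Algebra K L] {w : Fin 3 → L}

/-- By interpolation modulo the pencil, all cubics over `K` would vanish at `w`, including the cubes
of the coordinates. -/
theorem IsPencil.eq_zero_of_forall_cubic (h : IsPencil v q r)
    (hq : aeval w (q : MvPolynomial (Fin 3) K) = 0) (hr : aeval w (r : MvPolynomial (Fin 3) K) = 0)
    (hc : ∀ x, ∀ c : Form K 3, (∀ i, i ≠ x → evalForm (v i) c = 0) →
      aeval w (c : MvPolynomial (Fin 3) K) = 0) : w = 0 := by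
  obtain ⟨c, hcd⟩ := exists_dual _ h.generic.exists_cubic_avoiding
  ext j
  obtain ⟨s, t, hf⟩ := h.cubic_decomposition hcd ⟨X j ^ 3, isHomogeneous_X_pow j 3⟩
  have h1 := congrArg (fun f : Form K 3 => aeval w (f : MvPolynomial (Fin 3) K)) hf
  have h2 : ∀ i, aeval w (c i : MvPolynomial (Fin 3) K) = 0 := fun i =>
    hc i _ fun k hk => by rw [hcd, if_neg hk]
  simp only [Submodule.coe_add, Submodule.coe_sum, Submodule.coe_smul, map_add, map_sum, map_smul,
    h2, hq, hr, map_pow, aeval_X, smul_zero, Finset.sum_const_zero, add_zero] at h1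
  exact pow_eq_zero_iff (by norm_num) |>.1 h1

namespace IsResidual

variable {F : Form K 4} {l m : Fin 3 → K} {A B A' B' : Form K 2}

/-- If `k` did not vanish at `w`, then `F` would, and with it every quartic through the eight
points. The test quartics are `c * n`, with `c` a cubic through seven of the points and `n` a line
through the eighth. -/
theorem dot_eq_zero (h : IsResidual v q r F l m A B A' B') (hw : w ≠ 0)
    (hq : aeval w (q : MvPolynomial (Fin 3) K) = 0) (hr : aeval w (r : MvPolynomial (Fin 3) K) = 0)
    (hmult : ∀ i, SamePoint (fun j => algebraMap K L (v i j)) w →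
      grad w (q : MvPolynomial (Fin 3) K) ⨯₃ grad w (r : MvPolynomial (Fin 3) K) = 0)
    {k : Fin 3 → K} {C D : MvPolynomial (Fin 3) K}
    (hk : lin k * (F : MvPolynomial (Fin 3) K) = C * q + D * r) :
    (fun i => algebraMap K L (k i)) ⬝ᵥ w = 0 := by
  by_contra hkw
  have hFw : aeval w (F : MvPolynomial (Fin 3) K) = 0 := by
    have := congrArg (aeval w) hk
    rw [map_mul, map_add, map_mul, map_mul, hq, hr, aeval_lin, mul_zero, mul_zero, add_zero] at this
    exact (mul_eq_zero.1 this).resolve_left hkw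
  have hw0 : ∀ f : Form K 4, (∀ i, evalForm (v i) f = 0) →
      aeval w (f : MvPolynomial (Fin 3) K) = 0 := by
    intro f hf
    obtain ⟨s, a, b, hfs⟩ := h.exists_quartic_eq hf
    simp [hfs, hFw, hq, hr]
  have hprod : ∀ {x : Fin 8} {c : Form K 3} {n : Fin 3 → K},
      (∀ i, i ≠ x → evalForm (v i) c = 0) → n ⬝ᵥ v x = 0 →
      ∀ i, evalForm (v i) (mulForm (n := 4) rfl c (linForm n)) = 0 := by
    intro x c n hc hn i
    by_cases hi : i = x
    · subst hi
      simp [hn]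
    · have := hc i hi
      rw [evalForm_apply] at this
      simp [this]
  by_cases hex : ∃ i, SamePoint (fun j => algebraMap K L (v i j)) w
  -- When `w` is the point `v x`, differentiating `c * n` at `w` puts every line `n` through `v x`
  -- in the span of the gradients of `q` and `r`, which is at most one-dimensional.
  · obtain ⟨x, hx⟩ := hex
    have hcross := hmult x hx
    obtain ⟨c, hcx, hc⟩ := h.pencil.generic.exists_cubic_avoiding x
    have hcw : aeval w (c : MvPolynomial (Fin 3) K) ≠ 0 := by
      obtain ⟨t, ht, rfl⟩ := hx
      rw [aeval_smul_of_isHomogeneous c.isHomogeneous, aeval_algebraMap_comp, ← evalForm_apply]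
      exact mul_ne_zero (pow_ne_zero _ ht) (by simpa using hcx)
    have hspan : ∀ n : Fin 3 → K, n ⬝ᵥ v x = 0 → ∃ s t : L, (fun i => algebraMap K L (n i)) =
        s • grad w (q : MvPolynomial (Fin 3) K) + t • grad w (r : MvPolynomial (Fin 3) K) := by
      intro n hn
      obtain ⟨s, a, b, hfs⟩ := h.exists_quartic_eq (hprod hc hn)
      have g1 := congrArg (grad w) hfs
      have g2 := congrArg (grad w) hk
      have hnw : aeval w (lin n) = 0 := by
        obtain ⟨t, ht, rfl⟩ := hx
        rw [aeval_lin, dotProduct_smul, dot_map, hn, map_zero, smul_zero]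
      simp only [coe_mulForm, coe_linForm, grad_add, grad_mul, grad_smul, hq, hr, hnw, hFw,
        zero_smul, add_zero, grad_lin, aeval_lin] at g1 g2
      rw [zero_add] at g1
      refine ⟨(aeval w (c : MvPolynomial (Fin 3) K))⁻¹ * (algebraMap K L s *
        ((fun i => algebraMap K L (k i)) ⬝ᵥ w)⁻¹ * aeval w C + aeval w (a : MvPolynomial _ K)),
        (aeval w (c : MvPolynomial (Fin 3) K))⁻¹ * (algebraMap K L s *
        ((fun i => algebraMap K L (k i)) ⬝ᵥ w)⁻¹ * aeval w D + aeval w (b : MvPolynomial _ K)), ?_⟩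
      rw [(eq_inv_smul_iff₀ hcw).2 g1, (eq_inv_smul_iff₀ hkw).2 g2]
      module
    obtain ⟨n₁, n₂, h1, h2, h12⟩ := exists_pair_dot_eq_zero (h.pencil.generic.ne_zero x)
    obtain ⟨s₁, t₁, e1⟩ := hspan n₁ h1
    obtain ⟨s₂, t₂, e2⟩ := hspan n₂ h2
    apply cross_map_ne_zero (L := L) h12
    rw [e1, e2]
    have hcross' := cross_anticomm (grad w (q : MvPolynomial (Fin 3) K))
      (grad w (r : MvPolynomial (Fin 3) K))
    rw [hcross, neg_zero] at hcross'
    simp [hcross, ← hcross']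
  -- When `w` is a new point, some line `n` through `v x` misses it, so `c` itself vanishes at `w`;
  -- this holds for every `x`.
  · apply hw
    refine h.pencil.eq_zero_of_forall_cubic hq hr fun x c hc => ?_
    obtain ⟨n₁, n₂, h1, h2, h12⟩ := exists_pair_dot_eq_zero (h.pencil.generic.ne_zero x)
    have key : ∀ n : Fin 3 → K, n ⬝ᵥ v x = 0 → aeval w (c : MvPolynomial (Fin 3) K) = 0 ∨
        (fun i => algebraMap K L (n i)) ⬝ᵥ w = 0 := by
      intro n hn
      have := hw0 _ (hprod hc hn)
      rwa [coe_mulForm, coe_linForm, map_mul, aeval_lin, mul_eq_zero, or_comm] at this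
    refine (key n₁ h1).elim id fun h1w => (key n₂ h2).elim id fun h2w => ?_
    exfalso
    have h12' := cross_map_ne_zero (L := L) h12
    obtain ⟨a, ha⟩ := exists_smul_cross h12' h1w h2w
    obtain ⟨b, hb⟩ := exists_smul_cross h12' (w := fun j => algebraMap K L (v x j))
      (by rw [dot_map, h1, map_zero]) (by rw [dot_map, h2, map_zero])
    have hb0 : b ≠ 0 := by
      rintro rfl
      apply h.pencil.generic.ne_zero x
      ext j
      simpa using congrFun hb j
    have ha0 : a ≠ 0 := by
      rintro rfl
      exact hw (by rw [ha, zero_smul])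
    refine hex ⟨x, a * b⁻¹, mul_ne_zero ha0 (inv_ne_zero hb0), ?_⟩
    rw [hb, ha, smul_smul, inv_mul_cancel_right₀ hb0]

theorem samePoint (h : IsResidual v q r F l m A B A' B') (hw : w ≠ 0)
    (hq : aeval w (q : MvPolynomial (Fin 3) K) = 0) (hr : aeval w (r : MvPolynomial (Fin 3) K) = 0)
    (hmult : ∀ i, SamePoint (fun j => algebraMap K L (v i j)) w →
      grad w (q : MvPolynomial (Fin 3) K) ⨯₃ grad w (r : MvPolynomial (Fin 3) K) = 0) :
    SamePoint (fun j => algebraMap K L ((l ⨯₃ m) j)) w := by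
  obtain ⟨a, ha⟩ := exists_smul_cross (cross_map_ne_zero (L := L) h.cross_ne)
    (h.dot_eq_zero hw hq hr hmult h.mul_left) (h.dot_eq_zero hw hq hr hmult h.mul_right)
  refine ⟨a, ?_, by rw [ha, cross_map]⟩
  rintro rfl
  exact hw (by rw [ha, zero_smul])

end IsResidual

end Uniqueness

/-! ### Rational forms as real forms -/

section Descent

/-- A rational form, regarded as a real one. -/
def realForm {d : ℕ} (f : Form ℚ d) : TernaryForm d :=
  ⟨map (algebraMap ℚ ℝ) (f : MvPolynomial (Fin 3) ℚ), f.isHomogeneous.map _⟩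

@[simp] theorem coe_realForm {d : ℕ} (f : Form ℚ d) :
    (realForm f : MvPolynomial (Fin 3) ℝ) = map (algebraMap ℚ ℝ) (f : MvPolynomial (Fin 3) ℚ) := rfl

theorem realForm_add {d : ℕ} (f g : Form ℚ d) : realForm (f + g) = realForm f + realForm g :=
  Subtype.ext (by simp)

theorem realForm_smul {d : ℕ} (c : ℚ) (f : Form ℚ d) : realForm (c • f) = (c : ℝ) • realForm f :=
  Subtype.ext (by simp [smul_eq_C_mul])

theorem realForm_sum {d : ℕ} {ι : Type*} (s : Finset ι) (f : ι → Form ℚ d) :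
    realForm (∑ i ∈ s, f i) = ∑ i ∈ s, realForm (f i) :=
  Subtype.ext (by simp)

theorem toReal_eq (x : Fin 3 → ℚ) : toReal x = fun i => algebraMap ℚ ℝ (x i) := by
  ext i
  simp [toReal]

theorem toComplex_eq (x : Fin 3 → ℚ) : toComplex x = fun i => algebraMap ℚ ℂ (x i) := by
  ext i
  simp [toComplex]

theorem evalAt_realForm {d : ℕ} (x : Fin 3 → ℚ) (f : Form ℚ d) :
    evalAt (toReal x) (realForm f) = (eval x (f : MvPolynomial (Fin 3) ℚ) : ℝ) := by
  change aeval (toReal x) (map (algebraMap ℚ ℝ) (f : MvPolynomial (Fin 3) ℚ)) = _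
  rw [aeval_map_algebraMap, toReal_eq, aeval_algebraMap_comp]
  simp

theorem aeval_realForm {d : ℕ} (w : Fin 3 → ℂ) (f : Form ℚ d) :
    aeval w (realForm f : MvPolynomial (Fin 3) ℝ) = aeval w (f : MvPolynomial (Fin 3) ℚ) :=
  aeval_map_algebraMap ℝ w _

theorem gradientAt_realForm {d : ℕ} (w : Fin 3 → ℂ) (f : Form ℚ d) :
    gradientAt (realForm f) w = grad w (f : MvPolynomial (Fin 3) ℚ) := by
  ext i
  simp only [gradientAt, grad, coe_realForm, pderiv_map, aeval_map_algebraMap]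

theorem span_range_realForm (d : ℕ) :
    Submodule.span ℝ (Set.range (realForm (d := d))) = ⊤ := by
  rw [eq_top_iff]
  rintro f -
  have hmem : (f : MvPolynomial (Fin 3) ℝ) ∈ (Submodule.span ℝ (Set.range (realForm (d := d)))).map
      (homogeneousSubmodule (Fin 3) ℝ d).subtype := by
    rw [← support_sum_monomial_coeff (f : MvPolynomial (Fin 3) ℝ)]
    refine Submodule.sum_mem _ fun m hm => ?_
    have hdeg : m.degree = d := by
      by_contra hne
      exact mem_support_iff.1 hm (IsHomogeneous.coeff_eq_zero f.2 hne)
    refine ⟨coeff m (f : MvPolynomial (Fin 3) ℝ) •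
      realForm ⟨monomial m 1, isHomogeneous_monomial 1 hdeg⟩,
      Submodule.smul_mem _ _ (Submodule.subset_span ⟨_, rfl⟩), ?_⟩
    simp [smul_monomial]
  obtain ⟨g, hg, hgf⟩ := hmem
  rwa [← Subtype.ext hgf]

theorem isGeneric_of_genericityCondition {v : Fin 8 → Fin 3 → ℚ} (hv_ne : ∀ i, v i ≠ 0)
    (hv_inj : ∀ i j, SamePoint (v i) (v j) → i = j)
    (hv_gen : GenericityCondition (fun i => toReal (v i))) : IsGeneric v := by
  have hne : ∀ {d : ℕ} {f : Form ℚ d}, (f : MvPolynomial (Fin 3) ℚ) ≠ 0 → realForm f ≠ 0 := by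
    intro d f hf h0
    have := congrArg Subtype.val h0
    rw [coe_realForm] at this
    exact hf (map_injective _ (algebraMap ℚ ℝ).injective (by simpa using this))
  refine ⟨fun i j hij h0 => hij (hv_inj i j ((samePoint_iff_cross (hv_ne i) (hv_ne j)).2 h0)),
    fun a ha s hs => ?_, fun Q hQ s hs => ?_⟩
  · refine hv_gen.1 (realForm (linForm a)) (hne (lin_ne_zero ha)) s fun i hi => ?_
    rw [evalAt_realForm, coe_linForm, eval_lin, hs i hi, Rat.cast_zero]
  · refine hv_gen.2 (realForm Q) (hne fun h0 => hQ (Subtype.ext h0)) s fun i hi => ?_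
    rw [evalAt_realForm, hs i hi, Rat.cast_zero]

variable {v : Fin 8 → Fin 3 → ℚ} {q r : Form ℚ 3}

theorem IsPencil.realForm_mem_cubicsThrough (h : IsPencil v q r) :
    realForm q ∈ cubicsThrough (fun i => toReal (v i)) ∧
      realForm r ∈ cubicsThrough (fun i => toReal (v i)) :=
  ⟨fun i => by rw [evalAt_realForm, h.vanish_left i, Rat.cast_zero],
    fun i => by rw [evalAt_realForm, h.vanish_right i, Rat.cast_zero]⟩

/-- Interpolation modulo the pencil is linear in the cubic, so it extends from rational cubics to
their real span. -/
theorem IsPencil.exists_real_cubic_eq (h : IsPencil v q r) {f : TernaryForm 3}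
    (hf : f ∈ cubicsThrough (fun i => toReal (v i))) :
    ∃ s t : ℝ, f = s • realForm q + t • realForm r := by
  obtain ⟨c, hc⟩ := exists_dual _ h.generic.exists_cubic_avoiding
  have key : ∀ f : TernaryForm 3, ∃ s t : ℝ,
      f = ∑ i, evalAt (toReal (v i)) f • realForm (c i) + (s • realForm q + t • realForm r) := by
    intro f
    have hf : f ∈ Submodule.span ℝ (Set.range (realForm (d := 3))) := by
      rw [span_range_realForm]
      trivial
    induction hf using Submodule.span_induction with
    | mem f hf =>
      obtain ⟨f, rfl⟩ := hf
      obtain ⟨s, t, hst⟩ := h.cubic_decomposition hc f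
      refine ⟨s, t, ?_⟩
      nth_rewrite 1 [hst]
      simp only [realForm_add, realForm_smul, realForm_sum, evalAt_realForm, evalForm_apply]
    | zero => exact ⟨0, 0, by simp⟩
    | add f g _ _ hf hg =>
      obtain ⟨s, t, hf⟩ := hf
      obtain ⟨s', t', hg⟩ := hg
      refine ⟨s + s', t + t', ?_⟩
      nth_rewrite 1 [hf, hg]
      simp only [map_add, add_smul, Finset.sum_add_distrib]
      abel
    | smul a f _ hf =>
      obtain ⟨s, t, hf⟩ := hf
      refine ⟨a * s, a * t, ?_⟩
      nth_rewrite 1 [hf]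
      simp only [map_smul, smul_add, Finset.smul_sum, smul_smul, smul_eq_mul]
  obtain ⟨s, t, hst⟩ := key f
  refine ⟨s, t, ?_⟩
  rw [hst, Finset.sum_eq_zero fun i _ => by rw [hf i, zero_smul], zero_add]

theorem IsPencil.isNinthPoint_iff (h : IsPencil v q r) {w : Fin 3 → ℂ} :
    IsNinthPoint (fun i => toReal (v i)) w ↔ w ≠ 0 ∧ aeval w (q : MvPolynomial (Fin 3) ℚ) = 0 ∧
      aeval w (r : MvPolynomial (Fin 3) ℚ) = 0 ∧
      ∀ i, SamePoint (fun j => algebraMap ℚ ℂ (v i j)) w →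
        grad w (q : MvPolynomial (Fin 3) ℚ) ⨯₃ grad w (r : MvPolynomial (Fin 3) ℚ) = 0 := by
  have hcast : ∀ i, (fun j => ((toReal (v i) j : ℝ) : ℂ)) = fun j => algebraMap ℚ ℂ (v i j) := by
    intro i
    ext j
    simp [toReal]
  obtain ⟨hq, hr⟩ := h.realForm_mem_cubicsThrough
  constructor
  · rintro ⟨h0, h1, h2⟩
    refine ⟨h0, ?_, ?_, fun i hi => ?_⟩
    · rw [← aeval_realForm]; exact h1 _ hq
    · rw [← aeval_realForm]; exact h1 _ hr
    · rw [← gradientAt_realForm, ← gradientAt_realForm]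
      exact h2 i (by rwa [hcast]) _ hq _ hr
  · rintro ⟨h0, h1, h2, h3⟩
    refine ⟨h0, fun f hf => ?_, fun i hi f hf g hg => ?_⟩
    · obtain ⟨s, t, rfl⟩ := h.exists_real_cubic_eq hf
      rw [Submodule.coe_add, Submodule.coe_smul, Submodule.coe_smul, map_add, map_smul, map_smul,
        aeval_realForm, aeval_realForm, h1, h2, smul_zero, smul_zero, add_zero]
    · rw [hcast] at hi
      have h4 := h3 i hi
      have h5 := cross_anticomm (grad w (q : MvPolynomial (Fin 3) ℚ))
        (grad w (r : MvPolynomial (Fin 3) ℚ))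
      rw [h4, neg_zero] at h5
      have hgr : ∀ s t : ℝ, gradientAt (s • realForm q + t • realForm r) w =
          (s : ℂ) • grad w (q : MvPolynomial (Fin 3) ℚ) +
          (t : ℂ) • grad w (r : MvPolynomial (Fin 3) ℚ) := by
        intro s t
        rw [← gradientAt_realForm, ← gradientAt_realForm]
        change grad w _ = _ • grad w _ + _ • grad w _
        rw [Submodule.coe_add, Submodule.coe_smul, Submodule.coe_smul, grad_add, grad_smul,
          grad_smul]
        rfl
      obtain ⟨s, t, rfl⟩ := h.exists_real_cubic_eq hf
      obtain ⟨s', t', rfl⟩ := h.exists_real_cubic_eq hg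
      rw [hgr, hgr]
      simp [h4, ← h5]

theorem IsPencil.exists_ninthPoint (h : IsPencil v q r) : ∃ v9 : Fin 3 → ℚ,
    IsNinthPoint (fun i => toReal (v i)) (toComplex v9) ∧
      ∀ w : Fin 3 → ℂ, IsNinthPoint (fun i => toReal (v i)) w → SamePoint (toComplex v9) w := by
  obtain ⟨F, l, m, A, B, A', B', hres⟩ := h.exists_isResidual
  refine ⟨l ⨯₃ m, ?_, fun w hw => ?_⟩
  · rw [h.isNinthPoint_iff, toComplex_eq]
    have hne : (fun i => algebraMap ℚ ℂ ((l ⨯₃ m) i)) ≠ 0 := by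
      rw [← cross_map]
      exact cross_map_ne_zero hres.cross_ne
    refine ⟨hne, ?_, ?_, fun i hi => ?_⟩
    · rw [aeval_algebraMap_comp, hres.eval_left, map_zero]
    · rw [aeval_algebraMap_comp, hres.eval_right, map_zero]
    · have hgrad : ∀ f : MvPolynomial (Fin 3) ℚ, grad (fun i => algebraMap ℚ ℂ ((l ⨯₃ m) i)) f =
          fun i => algebraMap ℚ ℂ (grad (l ⨯₃ m) f i) := by
        intro f
        ext j
        simp only [grad, aeval_algebraMap_comp, aeval_eq_eval]
      rw [hgrad, hgrad, cross_map, hres.cross_grad_eq_zero (i := i)]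
      · ext j
        simp
      · rw [samePoint_iff_cross (h.generic.ne_zero i) hres.cross_ne]
        rw [samePoint_iff_cross _ hne, cross_map] at hi
        · ext j
          simpa using congrFun hi j
        · intro h0
          apply h.generic.ne_zero i
          ext j
          simpa using congrFun h0 j
  · obtain ⟨h0, h1, h2, h3⟩ := h.isNinthPoint_iff.1 hw
    rw [toComplex_eq]
    exact hres.samePoint h0 h1 h2 h3

end Descent

/-! ### Nine points -/

section NinePoints

variable {K : Type*} [Field K]

/-- Eight points in general position, two cubics spanning the pencil through them, and a ninth
base point of the pencil that differs from the eight points. -/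
structure IsBasePoint (v : Fin 8 → Fin 3 → K) (q r : Form K 3) (x : Fin 3 → K) : Prop where
  pencil : IsPencil v q r
  cross_ne : ∀ i, v i ⨯₃ x ≠ 0
  eval_left : eval x (q : MvPolynomial (Fin 3) K) = 0
  eval_right : eval x (r : MvPolynomial (Fin 3) K) = 0

namespace IsBasePoint

variable {v : Fin 8 → Fin 3 → K} {q r : Form K 3} {x : Fin 3 → K}

theorem ne_zero (h : IsBasePoint v q r x) : x ≠ 0 := by
  rintro rfl
  exact h.cross_ne 0 (by simp)

theorem snoc_ne_zero (h : IsBasePoint v q r x) (j : Fin 9) :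
    Fin.snoc (α := fun _ => Fin 3 → K) v x j ≠ 0 := by
  refine Fin.lastCases ?_ (fun i => ?_) j
  · rw [Fin.snoc_last]
    exact h.ne_zero
  · rw [Fin.snoc_castSucc]
    exact h.pencil.generic.ne_zero i

/-- Nine base points fail to impose independent conditions on cubics but do so on quartics: multiply
a cubic through seven of the eight points by a line through one remaining point that misses the
other. -/
theorem exists_quartic_avoiding (h : IsBasePoint v q r x) (j : Fin 9) :
    ∃ c : Form K 4, evalForm (Fin.snoc (α := fun _ => Fin 3 → K) v x j) c ≠ 0 ∧
      ∀ i, i ≠ j → evalForm (Fin.snoc (α := fun _ => Fin 3 → K) v x i) c = 0 := by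
  induction j using Fin.lastCases with
  | last =>
    obtain ⟨i, c, hc, hcx⟩ : ∃ i, ∃ c : Form K 3, (∀ k, k ≠ i → evalForm (v k) c = 0) ∧
        aeval x (c : MvPolynomial (Fin 3) K) ≠ 0 := by
      by_contra! hcon
      refine h.ne_zero (h.pencil.eq_zero_of_forall_cubic ?_ ?_ hcon)
      · rw [aeval_eq_eval]; exact h.eval_left
      · rw [aeval_eq_eval]; exact h.eval_right
    rw [aeval_eq_eval] at hcx
    obtain ⟨l, hl, hlx⟩ := exists_dot_eq_zero_ne_zero (h.cross_ne i)
    refine ⟨mulForm rfl (linForm l) c, ?_, fun k hk => ?_⟩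
    · rw [Fin.snoc_last]
      simpa [hlx] using hcx
    · induction k using Fin.lastCases with
      | last => exact absurd rfl hk
      | cast k =>
        rw [Fin.snoc_castSucc]
        by_cases hki : k = i
        · simp [hki, hl]
        · have := hc k hki
          rw [evalForm_apply] at this
          simp [this]
  | cast j =>
    obtain ⟨c, hcj, hc⟩ := h.pencil.generic.exists_cubic_avoiding j
    obtain ⟨l, hl, hlj⟩ := exists_dot_eq_zero_ne_zero (a := x) (b := v j) (by
      rw [← cross_anticomm, neg_ne_zero]
      exact h.cross_ne j)
    rw [evalForm_apply] at hcj
    refine ⟨mulForm rfl (linForm l) c, ?_, fun k hk => ?_⟩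
    · rw [Fin.snoc_castSucc]
      simp [hlj, hcj]
    · induction k using Fin.lastCases with
      | last =>
        rw [Fin.snoc_last]
        simp [hl]
      | cast k =>
        rw [Fin.snoc_castSucc]
        have := hc k fun hkj => hk (by rw [hkj])
        rw [evalForm_apply] at this
        simp [this]

theorem evalForm_pencilMap (h : IsBasePoint v q r x) {d n : ℕ} (hn : d + 3 = n)
    (e : Form K d × Form K d) (j : Fin 9) :
    evalForm (Fin.snoc (α := fun _ => Fin 3 → K) v x j) (pencilMap hn q r e) = 0 := by
  induction j using Fin.lastCases with
  | last => rw [Fin.snoc_last]; simp [h.eval_left, h.eval_right]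
  | cast i => simp [h.pencil.vanish_left i, h.pencil.vanish_right i]

theorem exists_quartic_eq (h : IsBasePoint v q r x) {f : Form K 4}
    (hf : ∀ j, evalForm (Fin.snoc (α := fun _ => Fin 3 → K) v x j) f = 0) :
    ∃ e, pencilMap (d := 1) rfl q r e = f := by
  refine exists_preimage_of_forall_eq_zero _ h.exists_quartic_avoiding
    _ (fun j e => h.evalForm_pencilMap rfl e j) ?_ hf
  rw [h.pencil.ker_pencilMap rfl (by norm_num), finrank_bot, finrank_form, finrank_prod,
    finrank_form, Fintype.card_fin]
  decide

theorem exists_sextic_avoiding (h : IsBasePoint v q r x) (j : Fin 9) :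
    ∃ c : Form K 6, evalForm (Fin.snoc (α := fun _ => Fin 3 → K) v x j) c ≠ 0 ∧
      ∀ i, i ≠ j → evalForm (Fin.snoc (α := fun _ => Fin 3 → K) v x i) c = 0 :=
  exists_form_avoiding_succ h.snoc_ne_zero
    (exists_form_avoiding_succ h.snoc_ne_zero h.exists_quartic_avoiding) j

/-- Both dimensions are `19`: `28 - 9` for sextics through the nine points, and `20 - 1` for `(q,
r)` in degree `6`, the one relation being Koszul. -/
theorem exists_sextic_eq (h : IsBasePoint v q r x) {f : Form K 6}
    (hf : ∀ j, evalForm (Fin.snoc (α := fun _ => Fin 3 → K) v x j) f = 0) :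
    ∃ e, pencilMap (d := 3) rfl q r e = f := by
  refine exists_preimage_of_forall_eq_zero _ h.exists_sextic_avoiding
    _ (fun j e => h.evalForm_pencilMap rfl e j) ?_ hf
  have := h.pencil.finrank_ker_pencilMap_three
  rw [finrank_form, finrank_prod, finrank_form, Fintype.card_fin,
    show Nat.choose (6 + 2) 2 = 28 by decide, show Nat.choose (3 + 2) 2 = 10 by decide]
  omega

/-- This makes every Cayley–Bacharach coefficient nonzero. Otherwise, for each line `n` through `v
i`, the quartic `n * c` contains all nine points and lies in `(q, r)`. Two such lines put `c` itself
into `(q, r)`, so `c` would vanish at `v i`. -/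
theorem eval_cubic_ne_zero (h : IsBasePoint v q r x) {i : Fin 8} {c : Form K 3}
    (hci : evalForm (v i) c ≠ 0) (hc : ∀ j, j ≠ i → evalForm (v j) c = 0) :
    eval x (c : MvPolynomial (Fin 3) K) ≠ 0 := by
  intro hcx
  have key : ∀ n : Fin 3 → K, n ⬝ᵥ v i = 0 → ∃ e : Form K 1 × Form K 1,
      lin n * (c : MvPolynomial (Fin 3) K) = e.1 * q + e.2 * r := by
    intro n hn
    obtain ⟨e, he⟩ := h.exists_quartic_eq (f := mulForm (d := 1) (e := 3) rfl c (linForm n)) (by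
      intro j
      induction j using Fin.lastCases with
      | last => rw [Fin.snoc_last]; simp [hcx]
      | cast j =>
        by_cases hj : j = i
        · simp [hj, hn]
        · have := hc j hj
          rw [evalForm_apply] at this
          simp [this])
    exact ⟨e, (congrArg Subtype.val he).symm⟩
  obtain ⟨n₁, n₂, h1, h2, h12⟩ := exists_pair_dot_eq_zero (h.pencil.generic.ne_zero i)
  obtain ⟨e₁, he₁⟩ := key n₁ h1
  obtain ⟨e₂, he₂⟩ := key n₂ h2
  obtain ⟨hA, hB⟩ := h.pencil.syzygy_eq_zero (d := 2) le_rfl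
    (A := lin n₂ * (e₁.1 : MvPolynomial (Fin 3) K) - lin n₁ * e₂.1)
    (B := lin n₂ * (e₁.2 : MvPolynomial (Fin 3) K) - lin n₁ * e₂.2)
    (((lin_isHomogeneous n₂).mul e₁.2.isHomogeneous).sub
      ((lin_isHomogeneous n₁).mul e₂.2.isHomogeneous))
    (by linear_combination lin n₁ * he₂ - lin n₂ * he₁)
  obtain ⟨A₀, B₀, -, -, hcAB⟩ := exists_eq_of_lin_mul_eq h12 (d := 0) e₁.1.isHomogeneous
    e₁.2.isHomogeneous he₁ (sub_eq_zero.1 hA) (sub_eq_zero.1 hB)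
  apply hci
  rw [evalForm_apply, hcAB]
  simp [h.pencil.vanish_left i, h.pencil.vanish_right i]

end IsBasePoint

end NinePoints

/-! ### Functionals on sextics -/

section Functionals

/-- The product of two ternary cubics. -/
def cubicMul (f g : TernaryForm 3) : TernaryForm 6 :=
  ⟨(f : MvPolynomial (Fin 3) ℝ) * g, IsHomogeneous.mul f.2 g.2⟩

@[simp] theorem evalAt_cubicMul (x : Fin 3 → ℝ) (f g : TernaryForm 3) :
    evalAt x (cubicMul f g) = evalAt x f * evalAt x g :=
  map_mul (aeval x) (f : MvPolynomial (Fin 3) ℝ) g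

theorem cubicMul_self_mem (f : TernaryForm 3) : cubicMul f f ∈ sosSextics :=
  ⟨1, fun _ => f, by simp [cubicMul, pow_two]⟩

theorem exists_eq_sum_cubicMul {f : TernaryForm 6} (hf : f ∈ sosSextics) :
    ∃ (n : ℕ) (g : Fin n → TernaryForm 3), f = ∑ i, cubicMul (g i) (g i) := by
  obtain ⟨n, g, hg⟩ := hf
  refine ⟨n, g, Subtype.ext ?_⟩
  simp [hg, cubicMul, pow_two]

/-- A null vector of a positive semidefinite form lies in its radical: along `g + t • f` the form is
affine in `t` and bounded below. -/
theorem apply_cubicMul_eq_zero {y : TernaryForm 6 →ₗ[ℝ] ℝ} (hy : y ∈ dualSosCone)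
    {f : TernaryForm 3} (hf : y (cubicMul f f) = 0) (g : TernaryForm 3) :
    y (cubicMul f g) = 0 := by
  have hexp : ∀ t : ℝ, 0 ≤ y (cubicMul g g) + 2 * t * y (cubicMul f g) := by
    intro t
    have h1 : cubicMul (g + t • f) (g + t • f) =
        cubicMul g g + (2 * t) • cubicMul f g + (t * t) • cubicMul f f := by
      apply Subtype.ext
      simp only [cubicMul, Submodule.coe_add, Submodule.coe_smul, smul_eq_C_mul, C_mul]
      rw [show (C 2 : MvPolynomial (Fin 3) ℝ) = 2 from rfl]
      ring
    have h2 := hy _ (cubicMul_self_mem (g + t • f))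
    rw [h1, map_add, map_add, map_smul, map_smul, hf, smul_zero, add_zero, smul_eq_mul] at h2
    exact h2
  by_contra hne
  -- This `t` makes the affine function equal to `-1`.
  have h1 := hexp (-(y (cubicMul g g) + 1) / (2 * y (cubicMul f g)))
  have h2 : 2 * (-(y (cubicMul g g) + 1) / (2 * y (cubicMul f g))) * y (cubicMul f g) =
      -(y (cubicMul g g) + 1) := by
    field_simp
  linarith

theorem pointFunctional_apply {m : ℕ} (a : Fin m → ℝ) (v : Fin m → Fin 3 → ℝ) (f : TernaryForm 6) :
    pointFunctional a v f = ∑ j, a j * evalAt (v j) f := by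
  simp [pointFunctional]

theorem pointFunctional_smul {m : ℕ} (t : ℝ) (a : Fin m → ℝ) (v : Fin m → Fin 3 → ℝ) :
    pointFunctional (fun j => t * a j) v = t • pointFunctional a v := by
  simp [pointFunctional, Finset.smul_sum, smul_smul]

theorem ninePoints_castSucc (v : Fin 8 → Fin 3 → ℝ) (x : Fin 3 → ℝ) (i : Fin 8) :
    ninePoints v x i.castSucc = v i := by
  simp [ninePoints]

theorem ninePoints_last (v : Fin 8 → Fin 3 → ℝ) (x : Fin 3 → ℝ) :
    ninePoints v x (Fin.last 8) = x := by
  rw [ninePoints, Fin.snoc_last]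

theorem ninePoints_toReal (v : Fin 8 → Fin 3 → ℚ) (x : Fin 3 → ℚ) (j : Fin 9) :
    ninePoints (fun i => toReal (v i)) (toReal x) j =
      toReal (Fin.snoc (α := fun _ => Fin 3 → ℚ) v x j) := by
  induction j using Fin.lastCases with
  | last => rw [ninePoints_last, Fin.snoc_last]
  | cast i => rw [ninePoints_castSucc, Fin.snoc_castSucc]

theorem realForm_mulForm (f g : Form ℚ 3) :
    realForm (mulForm (d := 3) (n := 6) rfl g f) = cubicMul (realForm g) (realForm f) :=
  Subtype.ext (by simp [cubicMul, mul_comm])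

variable {v : Fin 8 → Fin 3 → ℚ} {q r : Form ℚ 3} {x : Fin 3 → ℚ}

/-- The Cayley–Bacharach relation normalised by coefficient `-1` at the ninth point. -/
theorem IsPencil.evalAt_eq_sum (h : IsPencil v q r)
    (hq : eval x (q : MvPolynomial (Fin 3) ℚ) = 0) (hr : eval x (r : MvPolynomial (Fin 3) ℚ) = 0)
    {c : Fin 8 → Form ℚ 3} (hc : ∀ i j, evalForm (v i) (c j) = if i = j then 1 else 0)
    (f : TernaryForm 3) : evalAt (toReal x) f =
      ∑ i, ((eval x (c i : MvPolynomial (Fin 3) ℚ) : ℚ) : ℝ) * evalAt (toReal (v i)) f := by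
  have hlin : evalAt (d := 3) (toReal x) = ∑ i,
      ((eval x (c i : MvPolynomial (Fin 3) ℚ) : ℚ) : ℝ) • evalAt (toReal (v i)) := by
    refine LinearMap.ext_on (span_range_realForm 3) ?_
    rintro _ ⟨f, rfl⟩
    obtain ⟨s, t, hst⟩ := h.cubic_decomposition hc f
    simp only [LinearMap.sum_apply, LinearMap.smul_apply, evalAt_realForm, smul_eq_mul]
    have := congrArg (evalForm x) hst
    simp only [map_add, map_sum, map_smul, smul_eq_mul, evalForm_apply, hq, hr, mul_zero,
      add_zero] at this
    rw [this]
    push_cast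
    exact Finset.sum_congr rfl fun i _ => mul_comm _ _
  simpa using congrArg (fun φ : TernaryForm 3 →ₗ[ℝ] ℝ => φ f) hlin

theorem IsBasePoint.exists_eq_pointFunctional (h : IsBasePoint v q r x)
    {y : TernaryForm 6 →ₗ[ℝ] ℝ} (hq : ∀ g, y (cubicMul (realForm q) g) = 0)
    (hr : ∀ g, y (cubicMul (realForm r) g) = 0) :
    ∃ b : Fin 9 → ℝ, y = pointFunctional b (ninePoints (fun i => toReal (v i)) (toReal x)) := by
  obtain ⟨s, hs⟩ := exists_dual _ h.exists_sextic_avoiding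
  refine ⟨fun j => y (realForm (s j)), LinearMap.ext_on (span_range_realForm 6) ?_⟩
  rintro _ ⟨f, rfl⟩
  obtain ⟨e, he⟩ := h.exists_sextic_eq (f := f - ∑ j,
    evalForm (Fin.snoc (α := fun _ => Fin 3 → ℚ) v x j) f • s j) (by
      intro j
      rw [map_sub, map_sum]
      simp only [map_smul, hs, smul_eq_mul, mul_ite, mul_one, mul_zero, Finset.sum_ite_eq,
        Finset.mem_univ, if_true, sub_self])
  have hf : f = (mulForm rfl q e.1 + mulForm rfl r e.2) + ∑ j,
      evalForm (Fin.snoc (α := fun _ => Fin 3 → ℚ) v x j) f • s j := by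
    rw [← sub_eq_iff_eq_add, ← he]
    rfl
  rw [pointFunctional_apply]
  simp only [ninePoints_toReal, evalAt_realForm]
  nth_rewrite 1 [hf]
  rw [realForm_add, realForm_add, realForm_mulForm, realForm_mulForm, map_add, map_add, hq, hr,
    add_zero, zero_add, realForm_sum, map_sum]
  refine Finset.sum_congr rfl fun j _ => ?_
  rw [realForm_smul, map_smul, smul_eq_mul, mul_comm, evalForm_apply]

end Functionals

/-! ### Extreme rays from nine points -/

section ExtremeRay

variable {v : Fin 8 → Fin 3 → ℚ} {q r : Form ℚ 3} {x : Fin 3 → ℚ}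

theorem IsBasePoint.spansExtremeRay (h : IsBasePoint v q r x)
    {c : Fin 8 → Form ℚ 3} (hc : ∀ i j, evalForm (v i) (c j) = if i = j then 1 else 0)
    {ρ : Fin 8 → ℝ} (hρ : ∀ i, ρ i = ((eval x (c i : MvPolynomial (Fin 3) ℚ) : ℚ) : ℝ))
    {a : Fin 9 → ℝ} (ha : ∀ i : Fin 8, 0 < a i.castSucc)
    (hlast : a (Fin.last 8) * ∑ i, ρ i ^ 2 / a i.castSucc = -1) :
    SpansExtremeRay dualSosCone
      (pointFunctional a (ninePoints (fun i => toReal (v i)) (toReal x))) := by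
  set l := pointFunctional a (ninePoints (fun i => toReal (v i)) (toReal x)) with hl
  set S := ∑ i, ρ i ^ 2 / a i.castSucc with hS
  have hρ0 : ∀ i, ρ i ≠ 0 := by
    intro i
    rw [hρ]
    refine Rat.cast_ne_zero.2 (h.eval_cubic_ne_zero (i := i) ?_ fun j hj => ?_)
    · rw [hc, if_pos rfl]
      exact one_ne_zero
    · rw [hc, if_neg hj]
  have hx : ∀ f : TernaryForm 3, evalAt (toReal x) f = ∑ i, ρ i * evalAt (toReal (v i)) f := by
    intro f
    rw [h.pencil.evalAt_eq_sum h.eval_left h.eval_right hc]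
    simp only [hρ]
  have happly : ∀ f : TernaryForm 6, l f = ∑ i : Fin 8, a i.castSucc * evalAt (toReal (v i)) f +
      a (Fin.last 8) * evalAt (toReal x) f := by
    intro f
    rw [hl, pointFunctional_apply, Fin.sum_univ_castSucc]
    simp only [ninePoints_castSucc, ninePoints_last]
  have hSpos : 0 < S :=
    Finset.sum_pos (fun i _ => div_pos (sq_pos_of_ne_zero (hρ0 i)) (ha i)) ⟨0, Finset.mem_univ 0⟩
  have ha9 : a (Fin.last 8) = -(1 / S) := by
    field_simp
    linarith
  have hsq : ∀ f : TernaryForm 3, 0 ≤ l (cubicMul f f) := by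
    intro f
    rw [happly, ha9]
    simp only [evalAt_cubicMul]
    -- Cauchy–Schwarz: `f(x)² = (∑ ρᵢ f(vᵢ))² ≤ S * ∑ aᵢ f(vᵢ)²`.
    have hcs := Finset.sum_sq_le_sum_mul_sum_of_sq_le_mul Finset.univ
      (r := fun i => ρ i * evalAt (toReal (v i)) f) (f := fun i => ρ i ^ 2 / a i.castSucc)
      (g := fun i : Fin 8 => a i.castSucc * (evalAt (toReal (v i)) f * evalAt (toReal (v i)) f))
      (fun i _ => div_nonneg (sq_nonneg _) (ha i).le)
      (fun i _ => mul_nonneg (ha i).le (mul_self_nonneg _))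
      (fun i _ => by have := (ha i).ne'; exact le_of_eq (by field_simp))
    rw [← hx, ← hS, pow_two] at hcs
    have := (div_le_iff₀' hSpos).2 hcs
    rw [neg_mul, one_div_mul_eq_div]
    linarith
  have hmem : l ∈ dualSosCone := by
    intro f hf
    obtain ⟨n, g, rfl⟩ := exists_eq_sum_cubicMul hf
    rw [map_sum]
    exact Finset.sum_nonneg fun i _ => hsq (g i)
  have hdual : ∀ i j, evalAt (toReal (v i)) (realForm (c j)) = if i = j then 1 else 0 := by
    intro i j
    rw [evalAt_realForm, ← evalForm_apply, hc]
    split_ifs <;> simp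
  have hxc : ∀ j, evalAt (toReal x) (realForm (c j)) = ρ j := by
    intro j
    rw [evalAt_realForm, hρ]
  have hpos : 0 < l (cubicMul (realForm (c 0)) (realForm (c 0))) := by
    rw [happly]
    simp only [evalAt_cubicMul, hdual, hxc, mul_ite, mul_one, mul_zero, Finset.sum_ite_eq',
      Finset.mem_univ, if_true]
    have hlt : ρ 0 ^ 2 / a (Fin.castSucc 0) < S :=
      Finset.single_lt_sum (f := fun i : Fin 8 => ρ i ^ 2 / a i.castSucc) (i := 0) (j := 1)
        (by decide) (Finset.mem_univ _) (Finset.mem_univ _)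
        (div_pos (sq_pos_of_ne_zero (hρ0 1)) (ha 1))
        (fun i _ _ => div_nonneg (sq_nonneg _) (ha i).le)
    rw [div_lt_comm₀ (ha 0) hSpos] at hlt
    rw [ha9, neg_mul, one_div_mul_eq_div, ← pow_two]
    linarith
  -- The equality case of Cauchy–Schwarz, with `f₀(vᵢ) = ρᵢ / aᵢ` and `f₀(x) = S`.
  set f₀ : TernaryForm 3 := ∑ i, (ρ i / a i.castSucc) • realForm (c i) with hf₀
  have hf₀v : ∀ i, evalAt (toReal (v i)) f₀ = ρ i / a i.castSucc := by
    intro i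
    simp [hf₀, hdual]
  have hf₀x : evalAt (toReal x) f₀ = S := by
    rw [hx, hS]
    refine Finset.sum_congr rfl fun i _ => ?_
    rw [hf₀v]
    ring
  have hlf₀ : l (cubicMul f₀ f₀) = 0 := by
    rw [happly]
    simp only [evalAt_cubicMul, hf₀v, hf₀x]
    have : ∑ i : Fin 8, a i.castSucc * (ρ i / a i.castSucc * (ρ i / a i.castSucc)) = S := by
      refine Finset.sum_congr rfl fun i _ => ?_
      have := (ha i).ne'
      field_simp
    rw [this, ha9]
    field_simp
    ring
  obtain ⟨hqv, hrv⟩ := h.pencil.realForm_mem_cubicsThrough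
  have hlq : l (cubicMul (realForm q) (realForm q)) = 0 := by
    rw [happly]
    simp only [evalAt_cubicMul, hx (realForm q), hqv _]
    simp
  have hlr : l (cubicMul (realForm r) (realForm r)) = 0 := by
    rw [happly]
    simp only [evalAt_cubicMul, hx (realForm r), hrv _]
    simp
  have key : ∀ y ∈ dualSosCone, ∀ z ∈ dualSosCone, y + z = l → ∃ b : ℝ, 0 ≤ b ∧ y = b • l := by
    intro y hy z hz hyz
    have hker : ∀ f : TernaryForm 3, l (cubicMul f f) = 0 → ∀ g, y (cubicMul f g) = 0 := by
      intro f hf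
      refine apply_cubicMul_eq_zero hy ?_
      have h1 := hy _ (cubicMul_self_mem f)
      have h2 := hz _ (cubicMul_self_mem f)
      rw [← hyz, LinearMap.add_apply] at hf
      linarith
    obtain ⟨b, rfl⟩ := h.exists_eq_pointFunctional (hker _ hlq) (hker _ hlr)
    -- Pairing `f₀` with `c i` isolates one point: `bᵢ ρᵢ / aᵢ + b₉ S ρᵢ = 0`, and `ρᵢ` cancels.
    have hb : ∀ i : Fin 8, b i.castSucc = b (Fin.last 8) / a (Fin.last 8) * a i.castSucc := by
      intro i
      have h1 := hker _ hlf₀ (realForm (c i))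
      rw [pointFunctional_apply, Fin.sum_univ_castSucc] at h1
      simp only [ninePoints_castSucc, ninePoints_last, evalAt_cubicMul, hdual, hxc, hf₀v, hf₀x,
        mul_ite, mul_one, mul_zero, Finset.sum_ite_eq', Finset.mem_univ, if_true] at h1
      rw [ha9]
      have := (ha i).ne'
      field_simp at h1 ⊢
      rw [mul_zero] at h1
      linarith [(mul_eq_zero.1 h1).resolve_left (hρ0 i)]
    have hbl : pointFunctional b (ninePoints (fun i => toReal (v i)) (toReal x)) =
        (b (Fin.last 8) / a (Fin.last 8)) • l := by
      rw [hl, ← pointFunctional_smul]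
      congr 1
      ext j
      induction j using Fin.lastCases with
      | last =>
        rw [div_mul_cancel₀]
        rw [ha9]
        exact neg_ne_zero.2 (one_div_pos.2 hSpos).ne'
      | cast i => exact hb i
    refine ⟨_, ?_, hbl⟩
    have h1 := hy _ (cubicMul_self_mem (realForm (c 0)))
    rw [hbl, LinearMap.smul_apply, smul_eq_mul] at h1
    exact nonneg_of_mul_nonneg_left h1 hpos
  refine ⟨hmem, fun h0 => ?_, fun y hy z hz hyz => ⟨key y hy z hz hyz,
    key z hz y hy (by rw [add_comm, hyz])⟩⟩
  rw [h0, LinearMap.zero_apply] at hpos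
  exact lt_irrefl _ hpos

end ExtremeRay

/-! ### Rational certificates -/

section Certificate

theorem evalAt_smul {d : ℕ} (t : ℝ) (x : Fin 3 → ℝ) (f : TernaryForm d) :
    evalAt (t • x) f = t ^ d * evalAt x f :=
  aeval_smul_of_isHomogeneous f.2 t x

theorem continuous_evalAt {d : ℕ} (x : Fin 3 → ℝ) :
    Continuous fun f : TernaryForm d => evalAt x f := by
  have h : ∀ f : TernaryForm d, evalAt x f =
      ∑ m ∈ (Finset.univ : Finset (Fin 3)).finsuppAntidiag d,
        coeff m (f : MvPolynomial (Fin 3) ℝ) * ∏ i, x i ^ m i := by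
    intro f
    change aeval x (f : MvPolynomial (Fin 3) ℝ) = _
    rw [aeval_eq_eval, eval_eq']
    refine Finset.sum_subset (fun m hm => ?_) fun m _ hm => ?_
    · have hdeg : m.degree = d := by
        by_contra hne
        exact mem_support_iff.1 hm (IsHomogeneous.coeff_eq_zero f.2 hne)
      have : m ∈ {m : Fin 3 →₀ ℕ | m.degree = d} := hdeg
      rw [setOf_degree_eq] at this
      exact this
    · rw [notMem_support_iff.1 hm, zero_mul]
  simp only [h]
  refine continuous_finsetSum _ fun m _ => Continuous.mul ?_ continuous_const
  exact (continuous_apply m).comp continuous_induced_dom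

theorem isClosed_nonnegSextics : IsClosed nonnegSextics := by
  have : nonnegSextics = ⋂ x : Fin 3 → ℝ, {f | 0 ≤ evalAt x f} := by
    ext f
    simp [nonnegSextics]
  rw [this]
  exact isClosed_iInter fun x => isClosed_le continuous_const (continuous_evalAt x)

theorem exists_rational_certificate {p : TernaryForm 6} (hp : p ∈ nonnegSextics) {k : ℕ}
    {v : Fin 8 → Fin 3 → ℚ}
    (hp_zeros : ∀ x : Fin 3 → ℝ, x ≠ 0 →
      (evalAt x p = 0 ↔ ∃ i : Fin 8, (i : ℕ) < k ∧ SamePoint (toReal (v i)) x))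
    {q r : Form ℚ 3} (h : IsPencil v q r) {x : Fin 3 → ℚ}
    (hx : IsNinthPoint (fun i => toReal (v i)) (toComplex x)) {u : Fin 9 → ℝ}
    (hu : IsCayleyBacharachRelation (ninePoints (fun i => toReal (v i)) (toReal x)) u)
    (hlt : (∑ i ∈ Finset.univ.filter (fun i : Fin 8 => k ≤ (i : ℕ)), u i.castSucc ^ 2) *
        (∑ i ∈ Finset.univ.filter (fun i : Fin 8 => k ≤ (i : ℕ)), evalAt (toReal (v i)) p)
      < u (Fin.last 8) ^ 2 * evalAt (toReal x) p) :
    ∃ a : Fin 9 → ℚ,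
      SpansExtremeRay dualSosCone (pointFunctional (fun j => (a j : ℝ))
        (ninePoints (fun i => toReal (v i)) (toReal x))) ∧
      pointFunctional (fun j => (a j : ℝ)) (ninePoints (fun i => toReal (v i)) (toReal x)) p < 0 := by
  obtain ⟨-, hxq, hxr, -⟩ := h.isNinthPoint_iff.1 hx
  rw [toComplex_eq, aeval_algebraMap_comp] at hxq hxr
  have hq : eval x (q : MvPolynomial (Fin 3) ℚ) = 0 := by simpa using hxq
  have hr : eval x (r : MvPolynomial (Fin 3) ℚ) = 0 := by simpa using hxr
  obtain ⟨c, hc⟩ := exists_dual _ h.generic.exists_cubic_avoiding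
  set ρ : Fin 8 → ℚ := fun i => eval x (c i : MvPolynomial (Fin 3) ℚ) with hρ
  have hdual : ∀ i j, evalAt (toReal (v i)) (realForm (c j)) = if i = j then 1 else 0 := by
    intro i j
    rw [evalAt_realForm, ← evalForm_apply, hc]
    split_ifs <;> simp
  set s := Finset.univ.filter (fun i : Fin 8 => k ≤ (i : ℕ)) with hs
  set P := ∑ i ∈ s, evalAt (toReal (v i)) p with hP
  have hP0 : 0 ≤ P := Finset.sum_nonneg fun i _ => hp _
  -- the coefficients of a Cayley–Bacharach relation
  have hui : ∀ i : Fin 8, u i.castSucc = -(u (Fin.last 8) * ρ i) := by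
    intro i
    have := hu.2 (realForm (c i))
    rw [Fin.sum_univ_castSucc] at this
    simp only [ninePoints_castSucc, ninePoints_last, hdual, evalAt_realForm, mul_ite, mul_one,
      mul_zero, Finset.sum_ite_eq', Finset.mem_univ, if_true] at this
    linarith
  have hpos : 0 < u (Fin.last 8) ^ 2 * evalAt (toReal x) p :=
    lt_of_le_of_lt (mul_nonneg (Finset.sum_nonneg fun i _ => sq_nonneg _) hP0) hlt
  have hu9 : 0 < u (Fin.last 8) ^ 2 := pos_of_mul_pos_left hpos (hp _)
  have hpx : 0 < evalAt (toReal x) p := pos_of_mul_pos_right hpos hu9.le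
  have hlt' : (∑ i ∈ s, (ρ i : ℝ) ^ 2) * P < evalAt (toReal x) p := by
    have h1 : ∑ i ∈ s, u i.castSucc ^ 2 = u (Fin.last 8) ^ 2 * ∑ i ∈ s, (ρ i : ℝ) ^ 2 := by
      rw [Finset.mul_sum]
      refine Finset.sum_congr rfl fun i _ => ?_
      rw [hui]
      ring
    rw [h1, mul_assoc] at hlt
    exact lt_of_mul_lt_mul_left hlt hu9.le
  have hvne : ∀ i, toReal (v i) ≠ 0 := by
    intro i h0
    apply h.generic.ne_zero i
    ext j
    simpa [toReal] using congrFun h0 j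
  have hpv : ∀ i ∉ s, evalAt (toReal (v i)) p = 0 := by
    intro i hi
    rw [hp_zeros _ (hvne i)]
    exact ⟨i, by simpa [hs] using hi, 1, one_ne_zero, by simp⟩
  -- the ninth point is different from the others
  have hcross : ∀ i, v i ⨯₃ x ≠ 0 := by
    intro i hi
    obtain ⟨t, ht⟩ := exists_smul_of_cross_eq_zero (h.generic.ne_zero i) hi
    have htx : toReal x = (t : ℝ) • toReal (v i) := by
      ext j
      simp [toReal, ht]
    have hpt : evalAt (toReal x) p = (t : ℝ) ^ 6 * evalAt (toReal (v i)) p := by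
      rw [htx, evalAt_smul]
    have hρi : ρ i = t ^ 3 := by
      have h1 := aeval_smul_of_isHomogeneous (c i).isHomogeneous t (v i)
      rw [← ht, aeval_eq_eval, aeval_eq_eval] at h1
      have h2 := hc i i
      rw [evalForm_apply, if_pos rfl] at h2
      simpa [hρ, h2] using h1
    by_cases his : i ∈ s
    -- Here `p(x) = t⁶ p(vᵢ) = ρᵢ² p(vᵢ)`, a single term of the product of two sums of nonnegative
    -- terms, contrary to the strict inequality.
    · refine absurd hlt' (not_lt.2 ?_)
      have h1 : (ρ i : ℝ) ^ 2 ≤ ∑ i ∈ s, (ρ i : ℝ) ^ 2 :=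
        Finset.single_le_sum (f := fun i => (ρ i : ℝ) ^ 2) (fun i _ => sq_nonneg _) his
      have h2 : evalAt (toReal (v i)) p ≤ P :=
        Finset.single_le_sum (f := fun i => evalAt (toReal (v i)) p) (fun i _ => hp _) his
      have h3 := mul_le_mul h1 h2 (hp _) ((sq_nonneg _).trans h1)
      rw [hpt]
      refine le_trans (le_of_eq ?_) h3
      rw [hρi]
      push_cast
      ring
    · rw [hpt, hpv i his, mul_zero] at hpx
      exact lt_irrefl _ hpx
  have hbase : IsBasePoint v q r x := ⟨h, hcross, hq, hr⟩
  have hρ0 : ∀ i, ρ i ≠ 0 := by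
    intro i
    refine hbase.eval_cubic_ne_zero (i := i) ?_ fun j hj => ?_
    · rw [hc, if_pos rfl]
      exact one_ne_zero
    · rw [hc, if_neg hj]
  -- large weights on the zeros of the sextic
  set R : ℚ := ∑ i ∈ s, ρ i ^ 2 with hR
  set R' : ℚ := ∑ i ∈ sᶜ, ρ i ^ 2 with hR'
  -- With `S = R + R' / T`, the requirement `P * S < p(x)` becomes `R' * P / T < p(x) - R * P`,
  -- whose right side is positive by hypothesis. The `max` with `0` keeps `T` positive.
  obtain ⟨T, hT⟩ := exists_rat_gt (max 0 (R' * P / (evalAt (toReal x) p - R * P)))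
  have hT0 : (0 : ℝ) < T := lt_of_le_of_lt (le_max_left _ _) hT
  have hT1 := lt_of_le_of_lt (le_max_right _ _) hT
  have hTq : 0 < T := by exact_mod_cast hT0
  set w : Fin 8 → ℚ := fun i => if i ∈ s then 1 else T with hw
  have hw0 : ∀ i, 0 < w i := by
    intro i
    simp only [hw]
    split_ifs
    · exact one_pos
    · exact hTq
  set S : ℚ := ∑ i, ρ i ^ 2 / w i with hS
  have hS0 : 0 < S := Finset.sum_pos (fun i _ => div_pos (sq_pos_of_ne_zero (hρ0 i)) (hw0 i))
    ⟨0, Finset.mem_univ 0⟩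
  have hSR : S = R + R' / T := by
    rw [hS, ← Finset.sum_add_sum_compl s, hR, hR', Finset.sum_div]
    congr 1
    · refine Finset.sum_congr rfl fun i hi => ?_
      simp [hw, hi]
    · refine Finset.sum_congr rfl fun i hi => ?_
      rw [Finset.mem_compl] at hi
      simp [hw, hi]
  refine ⟨Fin.snoc (α := fun _ => ℚ) w (-(1 / S)), ?_, ?_⟩
  · refine hbase.spansExtremeRay hc (ρ := fun i => (ρ i : ℝ)) (fun i => rfl) (fun i => ?_) ?_
    · rw [Fin.snoc_castSucc]
      exact_mod_cast hw0 i
    · simp only [Fin.snoc_castSucc, Fin.snoc_last]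
      have : ∑ i, (ρ i : ℝ) ^ 2 / (w i : ℝ) = (S : ℝ) := by
        rw [hS]
        push_cast
        rfl
      rw [this]
      have : (S : ℝ) ≠ 0 := by exact_mod_cast hS0.ne'
      push_cast
      field_simp
  · rw [pointFunctional_apply, Fin.sum_univ_castSucc]
    simp only [Fin.snoc_castSucc, Fin.snoc_last, ninePoints_castSucc, ninePoints_last]
    have h1 : ∑ i, (w i : ℝ) * evalAt (toReal (v i)) p = P := by
      rw [← Finset.sum_add_sum_compl s, hP]
      rw [Finset.sum_eq_zero (s := sᶜ) fun i hi => by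
        rw [hpv i (Finset.mem_compl.1 hi), mul_zero], add_zero]
      refine Finset.sum_congr rfl fun i hi => ?_
      simp [hw, hi]
    have hSr : (0 : ℝ) < S := by exact_mod_cast hS0
    have hd : 0 < evalAt (toReal x) p - R * P := by
      rw [sub_pos, hR]
      push_cast
      exact hlt'
    rw [div_lt_iff₀ hd] at hT1
    have h2 : P * S < evalAt (toReal x) p := by
      rw [hSR]
      push_cast
      have h3 : R' * P / T < evalAt (toReal x) p - R * P := by
        rw [div_lt_iff₀ hT0]
        linarith
      calc P * (R + R' / T) = R * P + R' * P / T := by ring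
        _ < _ := by linarith
    rw [h1]
    push_cast
    have h4 : P < evalAt (toReal x) p / S := by rwa [lt_div_iff₀ hSr]
    rw [neg_mul, one_div_mul_eq_div]
    linarith

end Certificate

end TernarySextic

end

theorem corollary3p5
    (p : TernaryForm 6)
    (hp : p ∈ frontier nonnegSextics)
    (hp_sos : p ∉ sosSextics)
    (k : ℕ) (hk : k ≤ 8)
    (v : Fin 8 → Fin 3 → ℚ)
    (hv_ne : ∀ i, v i ≠ 0)
    (hv_inj : ∀ i j, SamePoint (v i) (v j) → i = j)
    (hv_gen : GenericityCondition (fun i => toReal (v i)))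
    -- the real projective variety of `p` consists of the first `k` points
    (hp_zeros : ∀ x : Fin 3 → ℝ, x ≠ 0 →
      (evalAt x p = 0 ↔
        ∃ i : Fin 8, (i : ℕ) < k ∧ SamePoint (toReal (v i)) x)) :
    -- the ninth point exists, is unique and is rational
    (∃ v9 : Fin 3 → ℚ,
      IsNinthPoint (fun i => toReal (v i))
        (toComplex v9) ∧
      ∀ w : Fin 3 → ℂ, IsNinthPoint (fun i => toReal (v i)) w →
        SamePoint (toComplex v9) w) ∧
    -- the inequality yields a rational certificate that spans an extreme ray
    (∀ v9 : Fin 3 → ℚ,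
      IsNinthPoint (fun i => toReal (v i))
        (toComplex v9) →
      ∀ u : Fin 9 → ℝ,
        IsCayleyBacharachRelation
          (ninePoints (fun i => toReal (v i))
            (toReal v9)) u →
        (∑ i ∈ Finset.univ.filter (fun i : Fin 8 => k ≤ (i : ℕ)), u i.castSucc ^ 2) *
            (∑ i ∈ Finset.univ.filter (fun i : Fin 8 => k ≤ (i : ℕ)),
              evalAt (toReal (v i)) p)
          < u (Fin.last 8) ^ 2 * evalAt (toReal v9) p →
        ∃ a : Fin 9 → ℚ,
          SpansExtremeRay dualSosCone
            (pointFunctional (fun j => (a j : ℝ))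
              (ninePoints (fun i => toReal (v i))
                (toReal v9))) ∧
          pointFunctional (fun j => (a j : ℝ))
              (ninePoints (fun i => toReal (v i))
                (toReal v9)) p < 0) := by
  have hgen := isGeneric_of_genericityCondition hv_ne hv_inj hv_gen
  obtain ⟨q, r, h⟩ := hgen.exists_isPencil
  have hnonneg : p ∈ nonnegSextics :=
    isClosed_nonnegSextics.closure_eq ▸ frontier_subset_closure hp
  exact ⟨h.exists_ninthPoint, fun v9 hv9 u hu hlt =>
    exists_rational_certificate hnonneg hp_zeros h hv9 hu hlt⟩
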